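/- Let $n\ge 1$, let $I=\,]a,b[$ be a bounded open interval, let $\lambda>0$ and $f\in L^2(I,\mathbb R^n)$. For an open interval $U\subset I$ and $w\in L^2(I,\mathbb R^n)$ put $$TV_U(w)=\sup\Big\{\int_U w\cdot\varphi'\,dx \;:\; \varphi\in C^1_c(U,\mathbb R^n),\ |\varphi|\le 1\Big\}\in[0,+\infty],$$ where $|\cdot|$ is the Euclidean norm. Write $w\in BV(U,\mathbb R^n)$ if $w\in L^1(U,\mathbb R^n)$ and the distributional derivative $w'$ of $w$ on $U$ is an $\mathbb R^n$-valued (finite) Borel measure on $U$; then $|w'|$ denotes the variation of this measure with respect to the Euclidean norm. Let $$E(w)=TV_I(w)+\frac1{2\lambda}\int_I|w-f|^2\,dx,\qquad w\in L^2(I,\mathbb R^n).$$ Then $E$ has exactly one minimizer $u$ in $L^2(I,\mathbb R^n)$, $u\in BV(I,\mathbb R^n)$, and the following hold. 1. If $U\subset I$ is a nonempty open interval and $f\in BV(U,\mathbb R^n)$, then $u\in BV(U,\mathbb R^n)$ and $|u'|\le|f'|$ in the sense of Borel measures on $U$, i.e. $|u'|(A)\le|f'|(A)$ for every Borel set $A\subset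 U$. 2. In particular, $TV_U(u)\le TV_U(f)$ for every nonempty open interval $U\subset I$ (without assuming $f\in BV(U,\mathbb R^n)$; the right-hand side may be $+\infty$). -/

import Mathlib

open MeasureTheory Set
open scoped ENNReal

noncomputable section

/-- The space `L²(]a,b[, ℝⁿ)`, where `ℝⁿ` carries the Euclidean norm. -/
abbrev L2Space (n : ℕ) (a b : ℝ) : Type :=
  Lp (EuclideanSpace ℝ (Fin n)) 2 ((volume : Measure ℝ).restrict (Ioo a b))

/-- `φ ∈ C¹_c(U, F)`, as a function on `ℝ` that vanishes outside a compact subset of `U`. -/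
def IsTestFunctionOn {F : Type*} [NormedAddCommGroup F] [NormedSpace ℝ F]
    (U : Set ℝ) (φ : ℝ → F) : Prop :=
  ContDiff ℝ 1 φ ∧ HasCompactSupport φ ∧ tsupport φ ⊆ U

/-- The vectorial total variation
`TV_U(u) = sup {∫_U u · φ' : φ ∈ C¹_c(U, ℝⁿ), |φ| ≤ 1} ∈ [0, ∞]`.
Since `φ = 0` is admissible, replacing negative integrals by `0` does not change the supremum. -/
def totalVariation {n : ℕ} (U : Set ℝ) (u : ℝ → EuclideanSpace ℝ (Fin n)) : ℝ≥0∞ :=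
  ⨆ (φ : ℝ → EuclideanSpace ℝ (Fin n)) (_ : IsTestFunctionOn U φ) (_ : ∀ x, ‖φ x‖ ≤ 1),
    ENNReal.ofReal (∫ x in U, inner ℝ (u x) (deriv φ x))

/-- The distributional derivative `u'` of `u` on `U` is (the restriction to `U` of) the
`ℝⁿ`-valued Borel measure `μ`:
`∫_U φ' u = - ∫_U φ dμ` for all scalar test functions `φ ∈ C¹_c(U)`.
Only the values of `μ` on Borel subsets of `U` matter. -/
def HasDerivMeasureOn {n : ℕ} (u : ℝ → EuclideanSpace ℝ (Fin n)) (U : Set ℝ)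
    (μ : VectorMeasure ℝ (EuclideanSpace ℝ (Fin n))) : Prop :=
  ∀ φ : ℝ → ℝ, IsTestFunctionOn U φ →
    ∫ x in U, deriv φ x • u x = - ∫ᵛ x in U, φ x ∂•μ

/-- `u ∈ BV(U, ℝⁿ)`: `u ∈ L¹(U, ℝⁿ)` and the distributional derivative of `u` on `U` is a
(finite) `ℝⁿ`-valued Borel measure. -/
def MemBV {n : ℕ} (u : ℝ → EuclideanSpace ℝ (Fin n)) (U : Set ℝ) : Prop :=
  IntegrableOn u U ∧ ∃ μ, HasDerivMeasureOn u U μ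

/-- The energy `E(w) = TV_I(w) + (1 / (2 l)) ∫_I |w - f|²` on `L²(I, ℝⁿ)`, `I = ]a,b[`. -/
def tvEnergy {n : ℕ} {a b : ℝ} (l : ℝ) (f w : L2Space n a b) : ℝ≥0∞ :=
  totalVariation (Ioo a b) w
    + ENNReal.ofReal (1 / (2 * l) * ∫ x in Ioo a b, ‖w x - f x‖ ^ 2)

/-- `u` minimizes the energy over `L²(I, ℝⁿ)`. -/
def IsTVMinimizer {n : ℕ} {a b : ℝ} (l : ℝ) (f u : L2Space n a b) : Prop :=
  ∀ w : L2Space n a b, tvEnergy l f u ≤ tvEnergy l f w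

end

/-!
The energy is handled through its dual problem. The total variation `TV` on `]a,b[` is the support
function of the set `K` of derivatives `φ'` of admissible test fields, so with `p` the projection
of `f / l` onto the closed convex set `closure K`, the function `u = f - l p` satisfies
`⟪u, p⟫ = TV(u)`. Comparing energies with `TV(w) ≥ ⟪w, p⟫` gives
`E(u) + |w - u|² / (2 l) ≤ E(w)` for every `w` (`IsDualSolution.energy_add_le`): `u` is the only
minimizer, and its total variation is finite.

The local comparison `TV_O(u) ≤ TV_O(f)` on an open set `O`
(`IsDualSolution.totalVariation_le_totalVariation`) comes from a choice of test field. Let `z` be an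
admissible field with `z' ≈ p`, let `φ` be admissible and supported in `O`, and let `η` be a cut-off
supported in `O` and equal to `1` on the support of `φ`. The field `ψ = η |z|^(2k) z` is admissible
for `TV_O(f)`. By Bernoulli's inequality `z + (φ - ψ) / (2k + 1)` is still admissible on `]a,b[`, so
maximality of `p` gives `⟪u, φ'⟫ ≤ ⟪u, ψ'⟫` up to an error that vanishes as `z' → p`. Since
`u = f - l p`, the right-hand side is about `⟪f, ψ'⟫ - l ⟪z', ψ'⟫`. The first term is at most
`TV_O(f)`. In `z' · ψ'` all terms are nonnegative squares except
`η' |z|^(2k) z · z' = η' (|z|^(2k+2))' / (2k + 2)`, and one integration by parts bounds its integral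
by `∫ |η''| / (2k + 2)`, which tends to `0` as `k → ∞`.

The comparison of the measures `|u'| ≤ |f'|` follows from the comparison of total variations on all
open subsets (`variation_le_variation_of_totalVariation_le`): for a Borel set `S`, inner and outer
regularity give a cut-off `χ` supported in an open `O ⊇ S` whose integral against `u'` is close to
`u'(S)`, and this integral is at most `TV_O(u) ≤ TV_O(f) ≤ |f'|(O)`.

That the distributional derivative of `u` is a measure is proved from finiteness of `TV(u)`
(`memBV_of_totalVariation_ne_top`). Mollification shows that `u` has bounded pointwise variation on
a set of full measure. There `u` is a Lipschitz function of its variation function, hence extends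
to a function of bounded variation on `ℝ`; the Stieltjes vector measure of this extension is the
derivative of `u`, by Fubini.
-/

open Filter Topology

/-! ### Test functions -/

section TestFunctions

variable {F : Type*} [NormedAddCommGroup F] [NormedSpace ℝ F] {U V : Set ℝ} {φ ψ : ℝ → F}

namespace IsTestFunctionOn

theorem mono (hφ : IsTestFunctionOn U φ) (h : U ⊆ V) : IsTestFunctionOn V φ :=
  ⟨hφ.1, hφ.2.1, hφ.2.2.trans h⟩

theorem zero : IsTestFunctionOn U (0 : ℝ → F) :=
  ⟨contDiff_const, HasCompactSupport.zero, by simp [tsupport]⟩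

theorem add (hφ : IsTestFunctionOn U φ) (hψ : IsTestFunctionOn U ψ) :
    IsTestFunctionOn U (φ + ψ) :=
  ⟨hφ.1.add hψ.1, hφ.2.1.add hψ.2.1,
    (tsupport_add φ ψ).trans (union_subset hφ.2.2 hψ.2.2)⟩

theorem const_smul (hφ : IsTestFunctionOn U φ) (c : ℝ) : IsTestFunctionOn U (c • φ) :=
  ⟨contDiff_const.smul hφ.1, hφ.2.1.smul_left (f := fun _ => c),
    (tsupport_smul_subset_right (fun _ => c) φ).trans hφ.2.2⟩

theorem smul {η : ℝ → ℝ} (hη : IsTestFunctionOn U η) (hψ : ContDiff ℝ 1 ψ) :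
    IsTestFunctionOn U (fun x => η x • ψ x) :=
  ⟨hη.1.smul hψ, hη.2.1.smul_right,
    (tsupport_smul_subset_left η ψ).trans hη.2.2⟩

theorem hasDerivAt (hφ : IsTestFunctionOn U φ) (x : ℝ) : HasDerivAt φ (deriv φ x) x :=
  (hφ.1.differentiable one_ne_zero x).hasDerivAt

theorem continuous_deriv (hφ : IsTestFunctionOn U φ) : Continuous (deriv φ) :=
  hφ.1.continuous_deriv le_rfl

theorem eq_zero (hφ : IsTestFunctionOn U φ) {x : ℝ} (hx : x ∉ U) : φ x = 0 :=
  image_eq_zero_of_notMem_tsupport fun h => hx (hφ.2.2 h)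

theorem deriv_eq_zero (hφ : IsTestFunctionOn U φ) {x : ℝ} (hx : x ∉ U) : deriv φ x = 0 := by
  by_contra h
  exact hx (hφ.2.2 (support_deriv_subset h))

theorem memLp_deriv (hφ : IsTestFunctionOn U φ) (p : ℝ≥0∞) (μ : Measure ℝ)
    [IsFiniteMeasureOnCompacts μ] : MemLp (deriv φ) p μ :=
  hφ.continuous_deriv.memLp_of_hasCompactSupport hφ.2.1.deriv

theorem integral_deriv [CompleteSpace F] (hφ : IsTestFunctionOn U φ) : ∫ x, deriv φ x = 0 :=
  integral_eq_zero_of_hasDerivAt_of_integrable hφ.hasDerivAt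
    (hφ.continuous_deriv.integrable_of_hasCompactSupport hφ.2.1.deriv)
    (hφ.1.continuous.integrable_of_hasCompactSupport hφ.2.1)

theorem exists_bound_deriv (hφ : IsTestFunctionOn U φ) : ∃ C, ∀ x, ‖deriv φ x‖ ≤ C :=
  hφ.2.1.deriv.exists_bound_of_continuous hφ.continuous_deriv

end IsTestFunctionOn

/-- Smooth cut-off functions for a compact subset of an open set. -/
theorem exists_smooth_cutoff {K U : Set ℝ} (hK : IsCompact K) (hU : IsOpen U) (hKU : K ⊆ U) :
    ∃ η : ℝ → ℝ, ContDiff ℝ 2 η ∧ IsTestFunctionOn U η ∧ (∀ x ∈ K, η x = 1) ∧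
      ∀ x, 0 ≤ η x ∧ η x ≤ 1 := by
  obtain ⟨L, hL, hKL, hLU⟩ := exists_compact_between hK hU hKU
  obtain ⟨η, h1, h0, h01⟩ := exists_contMDiffMap_one_nhds_of_subset_interior
    (n := 2) (modelWithCornersSelf ℝ ℝ) hK.isClosed hKL
  have hs : ContDiff ℝ 2 η := η.contMDiff.contDiff
  have hsupp : tsupport η ⊆ L :=
    closure_minimal (fun x hx => by_contra fun hxL => hx (h0 x hxL)) hL.isClosed
  exact ⟨η, hs, ⟨hs.of_le one_le_two, hL.of_isClosed_subset (isClosed_tsupport _) hsupp,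
    hsupp.trans hLU⟩, fun x hx => h1.self_of_nhdsSet x hx, fun x => h01 x⟩

end TestFunctions

section TotalVariation

variable {n : ℕ} {U V : Set ℝ} {w : ℝ → EuclideanSpace ℝ (Fin n)}
  {φ : ℝ → EuclideanSpace ℝ (Fin n)}

/-- The pairing of a function with the derivative of a test function does not see the domain of
integration outside the support of the test function. -/
theorem setIntegral_inner_deriv_eq (hφ : IsTestFunctionOn U φ) :
    ∫ x in U, inner ℝ (w x) (deriv φ x) = ∫ x, inner ℝ (w x) (deriv φ x) :=
  setIntegral_eq_integral_of_forall_compl_eq_zero fun x hx => by simp [hφ.deriv_eq_zero hx]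

theorem le_totalVariation (hφ : IsTestFunctionOn U φ) (h1 : ∀ x, ‖φ x‖ ≤ 1) :
    ENNReal.ofReal (∫ x in U, inner ℝ (w x) (deriv φ x)) ≤ totalVariation U w :=
  le_iSup_of_le φ (le_iSup_of_le hφ (le_iSup_of_le h1 le_rfl))

theorem totalVariation_le {C : ℝ≥0∞} (h : ∀ φ : ℝ → EuclideanSpace ℝ (Fin n),
    IsTestFunctionOn U φ → (∀ x, ‖φ x‖ ≤ 1) →
      ENNReal.ofReal (∫ x in U, inner ℝ (w x) (deriv φ x)) ≤ C) : totalVariation U w ≤ C :=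
  iSup_le fun φ => iSup_le fun hφ => iSup_le fun h1 => h φ hφ h1

theorem integral_le_toReal_totalVariation (hw : totalVariation U w ≠ ∞)
    (hφ : IsTestFunctionOn U φ) (h1 : ∀ x, ‖φ x‖ ≤ 1) :
    ∫ x in U, inner ℝ (w x) (deriv φ x) ≤ (totalVariation U w).toReal :=
  (ENNReal.ofReal_le_iff_le_toReal hw).1 (le_totalVariation hφ h1)

end TotalVariation

/-! ### Existence, uniqueness and the dual characterization of the minimizer -/

section Duality

variable {n : ℕ} {a b l : ℝ} {φ ψ : ℝ → EuclideanSpace ℝ (Fin n)} {f u w p : L2Space n a b}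

/-- The derivative of a test function as an element of `L²(]a,b[, ℝⁿ)`. -/
noncomputable def IsTestFunctionOn.derivLp (hφ : IsTestFunctionOn (Ioo a b) φ) : L2Space n a b :=
  (hφ.memLp_deriv 2 _).toLp (deriv φ)

theorem inner_derivLp (hφ : IsTestFunctionOn (Ioo a b) φ) (w : L2Space n a b) :
    inner ℝ w hφ.derivLp = ∫ x in Ioo a b, inner ℝ (w x) (deriv φ x) := by
  rw [L2.inner_def]
  refine integral_congr_ae ?_
  filter_upwards [(hφ.memLp_deriv 2 (volume.restrict (Ioo a b))).coeFn_toLp] with x hx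
  rw [IsTestFunctionOn.derivLp, hx]

theorem derivLp_add (hφ : IsTestFunctionOn (Ioo a b) φ) (hψ : IsTestFunctionOn (Ioo a b) ψ) :
    (hφ.add hψ).derivLp = hφ.derivLp + hψ.derivLp := by
  simp only [IsTestFunctionOn.derivLp]
  rw [← MemLp.toLp_add]
  congr 1
  ext1 x
  exact ((hφ.hasDerivAt x).add (hψ.hasDerivAt x)).deriv

theorem derivLp_const_smul (hφ : IsTestFunctionOn (Ioo a b) φ) (c : ℝ) :
    (hφ.const_smul c).derivLp = c • hφ.derivLp := by
  simp only [IsTestFunctionOn.derivLp]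
  rw [← MemLp.toLp_const_smul]
  congr 1
  ext1 x
  exact ((hφ.hasDerivAt x).const_smul c).deriv

variable (n a b) in
/-- The derivatives of the test functions admissible for the total variation on `]a,b[`. -/
def admissibleDerivs : Set (L2Space n a b) :=
  {k | ∃ (φ : ℝ → EuclideanSpace ℝ (Fin n)) (hφ : IsTestFunctionOn (Ioo a b) φ),
    (∀ x, ‖φ x‖ ≤ 1) ∧ hφ.derivLp = k}

theorem convex_admissibleDerivs : Convex ℝ (admissibleDerivs n a b) := by
  rintro _ ⟨φ, hφ, h1, rfl⟩ _ ⟨ψ, hψ, h2, rfl⟩ s t hs ht hst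
  refine ⟨_, (hφ.const_smul s).add (hψ.const_smul t), fun x => ?_, ?_⟩
  · calc ‖s • φ x + t • ψ x‖ ≤ ‖s • φ x‖ + ‖t • ψ x‖ := norm_add_le _ _
      _ = s * ‖φ x‖ + t * ‖ψ x‖ := by
        rw [norm_smul, norm_smul, Real.norm_of_nonneg hs, Real.norm_of_nonneg ht]
      _ ≤ s * 1 + t * 1 := by gcongr; exacts [h1 x, h2 x]
      _ = 1 := by linarith
  · rw [derivLp_add (hφ.const_smul s) (hψ.const_smul t), derivLp_const_smul hφ,
      derivLp_const_smul hψ]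

theorem zero_mem_admissibleDerivs : (0 : L2Space n a b) ∈ admissibleDerivs n a b := by
  refine ⟨0, IsTestFunctionOn.zero, by simp, ?_⟩
  have h := derivLp_const_smul (IsTestFunctionOn.zero (U := Ioo a b)
    (F := EuclideanSpace ℝ (Fin n))) 0
  simpa using h

/-- `TV` is the support function of the closed convex set generated by the admissible
derivatives. -/
theorem ofReal_inner_le_totalVariation (hp : p ∈ closure (admissibleDerivs n a b)) :
    ENNReal.ofReal (inner ℝ w p) ≤ totalVariation (Ioo a b) w := by
  have hcl : IsClosed {k : L2Space n a b |
      ENNReal.ofReal (inner ℝ w k) ≤ totalVariation (Ioo a b) w} :=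
    isClosed_le (ENNReal.continuous_ofReal.comp (by fun_prop)) continuous_const
  refine closure_minimal ?_ hcl hp
  rintro _ ⟨φ, hφ, h1, rfl⟩
  rw [mem_ofPred_eq, inner_derivLp]
  exact le_totalVariation hφ h1

/-- The derivative `p` of the dual solution: `p` lies in the closure of the admissible
derivatives, `u = f - l p`, and the pairing of `u` with admissible derivatives is maximal at `p`. -/
structure IsDualSolution (l : ℝ) (f u p : L2Space n a b) : Prop where
  mem_closure : p ∈ closure (admissibleDerivs n a b)
  eq_sub : u = f - l • p
  inner_le : ∀ k ∈ closure (admissibleDerivs n a b), inner ℝ u k ≤ inner ℝ u p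

/-- `l p` is the projection of `f` onto `l` times the closed convex set of (limits of) admissible
derivatives. -/
theorem exists_isDualSolution (hl : 0 < l) (f : L2Space n a b) :
    ∃ u p : L2Space n a b, IsDualSolution l f u p := by
  have hne : (closure (admissibleDerivs n a b)).Nonempty :=
    ⟨0, subset_closure zero_mem_admissibleDerivs⟩
  obtain ⟨p, hp, hmin⟩ := exists_norm_eq_iInf_of_complete_convex hne
    isClosed_closure.isComplete convex_admissibleDerivs.closure (l⁻¹ • f)
  rw [norm_eq_iInf_iff_real_inner_le_zero convex_admissibleDerivs.closure hp] at hmin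
  refine ⟨f - l • p, p, hp, rfl, fun k hk => ?_⟩
  have h : f - l • p = l • (l⁻¹ • f - p) := by
    rw [smul_sub, smul_smul, mul_inv_cancel₀ hl.ne', one_smul]
  have h2 := hmin k hk
  rw [inner_sub_right] at h2
  rw [h, inner_smul_left, inner_smul_left]
  exact mul_le_mul_of_nonneg_left (by linarith) hl.le

theorem integral_norm_sub_sq (w f : L2Space n a b) :
    ∫ x in Ioo a b, ‖w x - f x‖ ^ 2 = ‖w - f‖ ^ 2 := by
  rw [← real_inner_self_eq_norm_sq, L2.inner_def]
  refine integral_congr_ae ?_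
  filter_upwards [Lp.coeFn_sub w f] with x hx
  rw [hx, Pi.sub_apply, real_inner_self_eq_norm_sq]

namespace IsDualSolution

theorem inner_nonneg (h : IsDualSolution l f u p) : 0 ≤ inner ℝ u p := by
  simpa using h.inner_le 0 (subset_closure zero_mem_admissibleDerivs)

theorem totalVariation_le (h : IsDualSolution l f u p) :
    totalVariation (Ioo a b) u ≤ ENNReal.ofReal (inner ℝ u p) := by
  refine _root_.totalVariation_le fun φ hφ h1 => ENNReal.ofReal_le_ofReal ?_
  rw [← inner_derivLp hφ]
  exact h.inner_le _ (subset_closure ⟨φ, hφ, h1, rfl⟩)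

/-- Strong convexity of the energy at `u = f - l p`. -/
theorem energy_add_le (h : IsDualSolution l f u p) (hl : 0 < l) (w : L2Space n a b) :
    tvEnergy l f u + ENNReal.ofReal (1 / (2 * l) * ‖w - u‖ ^ 2) ≤ tvEnergy l f w := by
  have hc : 0 ≤ 1 / (2 * l) := by positivity
  have hf : f = u + l • p := by rw [h.eq_sub]; abel
  have hid : ‖w - f‖ ^ 2 = ‖w - u‖ ^ 2 - 2 * l * (inner ℝ w p - inner ℝ u p)
      + ‖u - f‖ ^ 2 := by
    have e1 : w - f = (w - u) - l • p := by rw [hf]; abel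
    have e2 : u - f = -(l • p) := by rw [hf]; abel
    rw [e1, e2, norm_neg, norm_sub_sq_real, inner_smul_right, inner_sub_left]
    ring
  simp only [tvEnergy, integral_norm_sub_sq]
  calc _ ≤ ENNReal.ofReal (inner ℝ u p) + ENNReal.ofReal (1 / (2 * l) * ‖u - f‖ ^ 2)
        + ENNReal.ofReal (1 / (2 * l) * ‖w - u‖ ^ 2) := by gcongr; exact h.totalVariation_le
    _ = ENNReal.ofReal (inner ℝ w p + 1 / (2 * l) * ‖w - f‖ ^ 2) := by
      rw [← ENNReal.ofReal_add h.inner_nonneg (by positivity),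
        ← ENNReal.ofReal_add (add_nonneg h.inner_nonneg (by positivity)) (by positivity)]
      congr 1
      rw [hid]
      field_simp
      ring
    _ ≤ ENNReal.ofReal (inner ℝ w p) + ENNReal.ofReal (1 / (2 * l) * ‖w - f‖ ^ 2) :=
      ENNReal.ofReal_add_le
    _ ≤ _ := by gcongr; exact ofReal_inner_le_totalVariation h.mem_closure

theorem energy_ne_top (h : IsDualSolution l f u p) : tvEnergy l f u ≠ ∞ :=
  ENNReal.add_ne_top.2
    ⟨ne_top_of_le_ne_top ENNReal.ofReal_ne_top h.totalVariation_le, ENNReal.ofReal_ne_top⟩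

theorem isTVMinimizer_iff (h : IsDualSolution l f u p) (hl : 0 < l) :
    IsTVMinimizer l f w ↔ w = u := by
  constructor
  · intro hw
    have h1 := (h.energy_add_le hl w).trans (hw u)
    have h2 : ENNReal.ofReal (1 / (2 * l) * ‖w - u‖ ^ 2) ≤ 0 := by
      refine (ENNReal.add_le_add_iff_left h.energy_ne_top).1 ?_
      simpa using h1
    have h3 : 1 / (2 * l) * ‖w - u‖ ^ 2 ≤ 0 := by simpa using h2
    have h4 : ‖w - u‖ ^ 2 ≤ 0 := by
      by_contra hpos
      push Not at hpos
      exact absurd h3 (not_le.2 (by positivity))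
    have h5 : ‖w - u‖ = 0 := by nlinarith [norm_nonneg (w - u)]
    exact sub_eq_zero.1 (norm_eq_zero.1 h5)
  · rintro rfl v
    exact le_self_add.trans (h.energy_add_le hl v)

end IsDualSolution

end Duality

/-! ### The localized test field `η |z|^(2k) z` -/

section PowerField

variable {F : Type*} [NormedAddCommGroup F] [InnerProductSpace ℝ F] {U V : Set ℝ}
  {η : ℝ → ℝ} {z φ : ℝ → F} {k : ℕ}

/-- The field `η |z|^(2k) z`: the cut-off `η` localizes it, and for large `k` the power of `|z|`
concentrates it near the contact set `|z| = 1`. -/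
def powerField (η : ℝ → ℝ) (z : ℝ → F) (k : ℕ) (x : ℝ) : F :=
  (η x * (‖z x‖ ^ 2) ^ k) • z x

theorem isTestFunctionOn_powerField (hη : IsTestFunctionOn U η) (hz : IsTestFunctionOn V z) :
    IsTestFunctionOn U (powerField η z k) := by
  have h := hη.smul (((hz.1.norm_sq ℝ).pow k).smul hz.1)
  have e : powerField η z k = fun x => η x • ((‖z x‖ ^ 2) ^ k • z x) := by
    ext1 x
    rw [powerField, smul_smul]
  rw [e]
  exact h

theorem hasDerivAt_powerField (hη : IsTestFunctionOn U η) (hz : IsTestFunctionOn V z) (x : ℝ) :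
    HasDerivAt (powerField η z k)
      ((η x * (‖z x‖ ^ 2) ^ k) • deriv z x + (deriv η x * (‖z x‖ ^ 2) ^ k
        + η x * (k * (‖z x‖ ^ 2) ^ (k - 1) * (2 * inner ℝ (z x) (deriv z x)))) • z x) x :=
  ((hη.hasDerivAt x).mul (((hz.hasDerivAt x).norm_sq).pow k)).smul (hz.hasDerivAt x)

theorem norm_powerField_le_one (hη1 : ∀ x, 0 ≤ η x ∧ η x ≤ 1) (hz1 : ∀ x, ‖z x‖ ≤ 1) (x : ℝ) :
    ‖powerField η z k x‖ ≤ 1 := by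
  have h0 := (hη1 x).1
  rw [powerField, norm_smul, Real.norm_of_nonneg (by positivity)]
  exact mul_le_one₀ (mul_le_one₀ (hη1 x).2 (by positivity)
    (pow_le_one₀ (by positivity) (pow_le_one₀ (norm_nonneg _) (hz1 x)))) (norm_nonneg _) (hz1 x)

theorem norm_deriv_powerField_le (hη : IsTestFunctionOn U η) (hz : IsTestFunctionOn V z)
    (hη1 : ∀ x, 0 ≤ η x ∧ η x ≤ 1) (hz1 : ∀ x, ‖z x‖ ≤ 1) (x : ℝ) :
    ‖deriv (powerField η z k) x‖ ≤ ‖deriv η x‖ + (2 * k + 1) * ‖deriv z x‖ := by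
  rw [(hasDerivAt_powerField hη hz x).deriv]
  obtain ⟨h0, h1⟩ := hη1 x
  have hzx := hz1 x
  have hs : ∀ m : ℕ, (‖z x‖ ^ 2) ^ m ≤ 1 := fun m =>
    pow_le_one₀ (by positivity) (pow_le_one₀ (norm_nonneg _) hzx)
  have e1 : ‖(η x * (‖z x‖ ^ 2) ^ k) • deriv z x‖ ≤ ‖deriv z x‖ := by
    rw [norm_smul, Real.norm_of_nonneg (by positivity)]
    exact mul_le_of_le_one_left (norm_nonneg _) (mul_le_one₀ h1 (by positivity) (hs k))
  have e2 : ‖deriv η x * (‖z x‖ ^ 2) ^ k‖ ≤ ‖deriv η x‖ := by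
    rw [norm_mul, Real.norm_of_nonneg (by positivity : 0 ≤ (‖z x‖ ^ 2) ^ k)]
    exact mul_le_of_le_one_right (norm_nonneg _) (hs k)
  have e3 : ‖inner ℝ (z x) (deriv z x)‖ ≤ ‖deriv z x‖ :=
    (norm_inner_le_norm _ _).trans (mul_le_of_le_one_left (norm_nonneg _) hzx)
  have e4 : ‖η x * (k * (‖z x‖ ^ 2) ^ (k - 1) * (2 * inner ℝ (z x) (deriv z x)))‖
      ≤ 2 * k * ‖deriv z x‖ := by
    rw [norm_mul, norm_mul, norm_mul, norm_mul, Real.norm_of_nonneg h0,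
      Real.norm_of_nonneg (by positivity : 0 ≤ (‖z x‖ ^ 2) ^ (k - 1)), Real.norm_natCast,
      Real.norm_two]
    calc η x * (k * (‖z x‖ ^ 2) ^ (k - 1) * (2 * ‖inner ℝ (z x) (deriv z x)‖))
        ≤ 1 * (k * 1 * (2 * ‖deriv z x‖)) := by gcongr; exact hs _
      _ = 2 * k * ‖deriv z x‖ := by ring
  calc _ ≤ ‖(η x * (‖z x‖ ^ 2) ^ k) • deriv z x‖ + ‖(deriv η x * (‖z x‖ ^ 2) ^ k
        + η x * (k * (‖z x‖ ^ 2) ^ (k - 1) * (2 * inner ℝ (z x) (deriv z x)))) • z x‖ :=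
      norm_add_le _ _
    _ ≤ ‖deriv z x‖ + (‖deriv η x‖ + 2 * k * ‖deriv z x‖) * 1 := by
      rw [norm_smul (_ + _)]
      gcongr
      exact (norm_add_le _ _).trans (add_le_add e2 e4)
    _ = _ := by ring

/-- The quadratic terms of `z' · (η |z|^(2k) z)'` have a sign; what is left is an exact
derivative times `η'`. -/
theorem le_inner_deriv_powerField (hη : IsTestFunctionOn U η) (hz : IsTestFunctionOn V z)
    (hη1 : ∀ x, 0 ≤ η x ∧ η x ≤ 1) (x : ℝ) :
    (2 * (k + 1 : ℝ))⁻¹ * (deriv η x * deriv (fun y => (‖z y‖ ^ 2) ^ (k + 1)) x)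
      ≤ inner ℝ (deriv z x) (deriv (powerField η z k) x) := by
  have h0 := (hη1 x).1
  rw [(hasDerivAt_powerField hη hz x).deriv,
    (((hz.hasDerivAt x).norm_sq).fun_pow (k + 1)).deriv, inner_add_right, inner_smul_right,
    inner_smul_right, real_inner_self_eq_norm_sq, real_inner_comm (z x) (deriv z x)]
  set c := inner ℝ (z x) (deriv z x)
  have e : (2 * (k + 1 : ℝ))⁻¹ * (deriv η x * (((k + 1 : ℕ) : ℝ) * (‖z x‖ ^ 2) ^ (k + 1 - 1)
      * (2 * c))) = deriv η x * (‖z x‖ ^ 2) ^ k * c := by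
    rw [Nat.add_sub_cancel]
    push_cast
    field_simp
  rw [e]
  have p1 : 0 ≤ η x * (‖z x‖ ^ 2) ^ k * ‖deriv z x‖ ^ 2 := by positivity
  have p2 : 0 ≤ η x * (k * (‖z x‖ ^ 2) ^ (k - 1) * 2) * c ^ 2 := by positivity
  nlinarith [p1, p2]

/-- The energy pairing of `z'` with the derivative of `η |z|^(2k) z` is almost nonnegative, with an
error that vanishes as `k → ∞`. -/
theorem neg_le_integral_inner_deriv_powerField (hη2 : ContDiff ℝ 2 η)
    (hη : IsTestFunctionOn U η) (hz : IsTestFunctionOn V z)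
    (hη1 : ∀ x, 0 ≤ η x ∧ η x ≤ 1) (hz1 : ∀ x, ‖z x‖ ≤ 1) :
    -((2 * (k + 1 : ℝ))⁻¹ * ∫ x, ‖deriv (deriv η) x‖)
      ≤ ∫ x, inner ℝ (deriv z x) (deriv (powerField η z k) x) := by
  have hψ : IsTestFunctionOn U (powerField η z k) := isTestFunctionOn_powerField hη hz
  set s : ℝ → ℝ := fun y => (‖z y‖ ^ 2) ^ (k + 1) with hs
  have hsC : ContDiff ℝ 1 s := (hz.1.norm_sq ℝ).pow (k + 1)
  have hη' : ContDiff ℝ 1 (deriv η) := by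
    have h2 : ContDiff ℝ (1 + 1) η := by simpa [one_add_one_eq_two] using hη2
    exact (contDiff_succ_iff_deriv.1 h2).2.2
  have hc : HasCompactSupport (deriv η) := hη.2.1.deriv
  have i1 : Integrable (fun x => deriv η x * deriv s x) :=
    (hη'.continuous.mul (hsC.continuous_deriv le_rfl)).integrable_of_hasCompactSupport
      hc.mul_right
  have i2 : Integrable (fun x => deriv (deriv η) x * s x) :=
    ((hη'.continuous_deriv le_rfl).mul hsC.continuous).integrable_of_hasCompactSupport
      hc.deriv.mul_right
  have i3 : Integrable (fun x => deriv η x * s x) :=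
    (hη'.continuous.mul hsC.continuous).integrable_of_hasCompactSupport hc.mul_right
  have hparts : ∫ x, deriv η x * deriv s x = - ∫ x, deriv (deriv η) x * s x :=
    integral_mul_deriv_eq_deriv_mul_of_integrable
      (fun x _ => (hη'.differentiable one_ne_zero x).hasDerivAt)
      (fun x _ => (hsC.differentiable one_ne_zero x).hasDerivAt) i1 i2 i3
  have i4 : Integrable (fun x => ‖deriv (deriv η) x‖) :=
    ((hη'.continuous_deriv le_rfl).integrable_of_hasCompactSupport hc.deriv).norm
  have hle : ∫ x, deriv (deriv η) x * s x ≤ ∫ x, ‖deriv (deriv η) x‖ := by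
    refine integral_mono i2 i4 fun x => (le_abs_self _).trans ?_
    rw [abs_mul, ← Real.norm_eq_abs, abs_of_nonneg (by positivity)]
    exact mul_le_of_le_one_right (norm_nonneg _)
      (pow_le_one₀ (by positivity) (pow_le_one₀ (norm_nonneg _) (hz1 x)))
  calc -((2 * (k + 1 : ℝ))⁻¹ * ∫ x, ‖deriv (deriv η) x‖)
      ≤ (2 * (k + 1 : ℝ))⁻¹ * ∫ x, deriv η x * deriv s x := by
        rw [hparts, mul_neg, neg_le_neg_iff]
        gcongr
    _ = ∫ x, (2 * (k + 1 : ℝ))⁻¹ * (deriv η x * deriv s x) := (integral_const_mul _ _).symm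
    _ ≤ _ := by
      refine integral_mono (i1.const_mul _) ?_ fun x => le_inner_deriv_powerField hη hz hη1 x
      exact (hz.continuous_deriv.inner hψ.continuous_deriv).integrable_of_hasCompactSupport
        (hψ.2.1.deriv.mono fun x hx h => hx (by simp [h]))

/-- Replacing a `1/(2k+1)` portion of the localized field by another field dominated by `η` keeps
`z` admissible: with `r = |z|` this is Bernoulli's inequality `1 - r^(2k+1) ≤ (2k+1)(1-r)`. -/
theorem norm_add_smul_sub_powerField_le_one (hη1 : ∀ x, 0 ≤ η x ∧ η x ≤ 1)
    (hz1 : ∀ x, ‖z x‖ ≤ 1) (hφ : ∀ x, ‖φ x‖ ≤ η x) (x : ℝ) :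
    ‖z x + (2 * k + 1 : ℝ)⁻¹ • (φ x - powerField η z k x)‖ ≤ 1 := by
  obtain ⟨h0, h1⟩ := hη1 x
  set t : ℝ := (2 * k + 1 : ℝ)⁻¹ with ht
  have htpos : 0 < t := by positivity
  have htmul : t * (2 * k + 1) = 1 := inv_mul_cancel₀ (by positivity)
  have ht1 : t ≤ 1 := inv_le_one_of_one_le₀ (by linarith [(Nat.cast_nonneg k : (0 : ℝ) ≤ k)])
  set r := ‖z x‖ with hr
  have hr0 : 0 ≤ r := norm_nonneg _
  have hrk : r ^ (2 * k) ≤ 1 := pow_le_one₀ hr0 (hz1 x)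
  have e : z x + t • (φ x - powerField η z k x)
      = (1 - t * (η x * r ^ (2 * k))) • z x + t • φ x := by
    rw [powerField, ← pow_mul, ← hr, sub_smul, one_smul, smul_sub, smul_smul]
    abel
  have hcoef : 0 ≤ 1 - t * (η x * r ^ (2 * k)) := by
    have := mul_le_one₀ ht1 (by positivity) (mul_le_one₀ h1 (by positivity) hrk)
    linarith
  have bern : 1 + ((2 * k + 1 : ℕ) : ℝ) * (r - 1) ≤ (1 + (r - 1)) ^ (2 * k + 1) :=
    one_add_mul_le_pow (by linarith) _
  rw [add_sub_cancel, pow_succ] at bern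
  push_cast at bern
  have hpow1 : r ^ (2 * k) * r ≤ 1 := mul_le_one₀ hrk hr0 (hz1 x)
  have hb : t * (1 - r ^ (2 * k) * r) ≤ 1 - r := by
    calc t * (1 - r ^ (2 * k) * r) ≤ t * ((2 * k + 1) * (1 - r)) := by
          gcongr
          linarith
      _ = 1 - r := by rw [← mul_assoc, htmul, one_mul]
  have hb2 : η x * (t * (1 - r ^ (2 * k) * r)) ≤ t * (1 - r ^ (2 * k) * r) :=
    mul_le_of_le_one_left (mul_nonneg htpos.le (by linarith)) h1
  have hφt : t * ‖φ x‖ ≤ t * η x := mul_le_mul_of_nonneg_left (hφ x) htpos.le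
  calc _ ≤ ‖(1 - t * (η x * r ^ (2 * k))) • z x‖ + ‖t • φ x‖ := by
        rw [e]
        exact norm_add_le _ _
    _ = (1 - t * (η x * r ^ (2 * k))) * r + t * ‖φ x‖ := by
      rw [norm_smul, norm_smul, Real.norm_of_nonneg hcoef, Real.norm_of_nonneg htpos.le]
    _ ≤ 1 := by nlinarith [hb, hb2, hφt]

end PowerField

/-! ### Local comparison of total variations -/

section Comparison

variable {n : ℕ} {a b l : ℝ} {f u p : L2Space n a b} {U : Set ℝ}
  {z φ : ℝ → EuclideanSpace ℝ (Fin n)} {η : ℝ → ℝ} {k : ℕ}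

/-- `L²` bound for the derivative of the localized field, linear in `z'`. -/
theorem norm_derivLp_powerField_le (hη : IsTestFunctionOn (Ioo a b) η)
    (hz : IsTestFunctionOn (Ioo a b) z) (hη1 : ∀ x, 0 ≤ η x ∧ η x ≤ 1) (hz1 : ∀ x, ‖z x‖ ≤ 1) :
    ‖(isTestFunctionOn_powerField (k := k) hη hz).derivLp‖
      ≤ (eLpNorm (deriv η) 2 (volume.restrict (Ioo a b))).toReal + (2 * k + 1) * ‖hz.derivLp‖ := by
  set μ := volume.restrict (Ioo a b)
  have m1 : MemLp (fun x => ‖deriv η x‖) 2 μ := (hη.memLp_deriv 2 μ).norm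
  have m2 : MemLp (fun x => (2 * k + 1 : ℝ) * ‖deriv z x‖) 2 μ :=
    (hz.memLp_deriv 2 μ).norm.const_mul _
  have hk : ‖(2 * k + 1 : ℝ)‖ₑ ≠ ∞ := enorm_ne_top
  have key : eLpNorm (deriv (powerField η z k)) 2 μ
      ≤ eLpNorm (deriv η) 2 μ + ‖(2 * k + 1 : ℝ)‖ₑ * eLpNorm (deriv z) 2 μ := by
    calc _ ≤ eLpNorm ((fun x => ‖deriv η x‖) + fun x => (2 * k + 1 : ℝ) * ‖deriv z x‖) 2 μ :=
          eLpNorm_mono_real fun x => norm_deriv_powerField_le hη hz hη1 hz1 x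
      _ ≤ _ := eLpNorm_add_le m1.1 m2.1 one_le_two
      _ = _ := by
        congr 1
        · exact eLpNorm_norm _
        · have := eLpNorm_const_smul (2 * k + 1 : ℝ) (fun x => ‖deriv z x‖) 2 μ
          rw [eLpNorm_norm] at this
          exact this
  have f1 := (hη.memLp_deriv 2 μ).eLpNorm_ne_top
  have f2 := (hz.memLp_deriv 2 μ).eLpNorm_ne_top
  rw [IsTestFunctionOn.derivLp, IsTestFunctionOn.derivLp, Lp.norm_toLp, Lp.norm_toLp]
  have h := ENNReal.toReal_mono (ENNReal.add_ne_top.2 ⟨f1, ENNReal.mul_ne_top hk f2⟩) key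
  rwa [ENNReal.toReal_add f1 (ENNReal.mul_ne_top hk f2), ENNReal.toReal_mul, toReal_enorm,
    Real.norm_of_nonneg (by positivity)] at h

/-- The comparison for one field `φ ≤ η`, one power `k` and one approximation `z` of the dual
solution, with explicit errors. -/
theorem IsDualSolution.inner_derivLp_le (h : IsDualSolution l f u p) (hl : 0 < l)
    (hU : U ⊆ Ioo a b) (hf : totalVariation U f ≠ ∞)
    (hη2 : ContDiff ℝ 2 η) (hη : IsTestFunctionOn U η) (hη1 : ∀ x, 0 ≤ η x ∧ η x ≤ 1)
    (hz : IsTestFunctionOn (Ioo a b) z) (hz1 : ∀ x, ‖z x‖ ≤ 1)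
    (hφ : IsTestFunctionOn (Ioo a b) φ) (hφη : ∀ x, ‖φ x‖ ≤ η x) :
    inner ℝ u hφ.derivLp ≤ (totalVariation U f).toReal
      + l * ((2 * (k + 1 : ℝ))⁻¹ * ∫ x, ‖deriv (deriv η) x‖)
      + ‖hz.derivLp - p‖ * ((2 * k + 1) * ‖u‖ + l *
        ((eLpNorm (deriv η) 2 (volume.restrict (Ioo a b))).toReal
          + (2 * k + 1) * ‖hz.derivLp‖)) := by
  have hηI := hη.mono hU
  have hψU : IsTestFunctionOn U (powerField η z k) := isTestFunctionOn_powerField hη hz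
  have hψ : IsTestFunctionOn (Ioo a b) (powerField η z k) := isTestFunctionOn_powerField hηI hz
  have hnψ : ‖hψ.derivLp‖ ≤ _ := norm_derivLp_powerField_le hηI hz hη1 hz1
  -- maximality of the dual solution against the competitor `z + (φ - ψ) / (2 k + 1)`
  have hnegψ := hψ.const_smul (-1)
  have hcomp : inner ℝ u (hz.derivLp + (2 * k + 1 : ℝ)⁻¹ • (hφ.derivLp - hψ.derivLp))
      ≤ inner ℝ u p := by
    refine h.inner_le _ (subset_closure ⟨_, hz.add ((hφ.add hnegψ).const_smul
      (2 * k + 1 : ℝ)⁻¹), fun x => ?_, ?_⟩)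
    · have := norm_add_smul_sub_powerField_le_one (k := k) hη1 hz1 hφη x
      simpa [sub_eq_add_neg] using this
    · rw [derivLp_add hz ((hφ.add hnegψ).const_smul _), derivLp_const_smul (hφ.add hnegψ),
        derivLp_add hφ hnegψ, derivLp_const_smul hψ, neg_one_smul, sub_eq_add_neg]
  have h1 : inner ℝ u hφ.derivLp
      ≤ inner ℝ u hψ.derivLp + (2 * k + 1) * (‖hz.derivLp - p‖ * ‖u‖) := by
    have hcs : -inner ℝ u (hz.derivLp - p) ≤ ‖hz.derivLp - p‖ * ‖u‖ := by
      rw [mul_comm]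
      exact (neg_le_abs _).trans (abs_real_inner_le_norm _ _)
    rw [inner_add_right, inner_smul_right, inner_sub_right] at hcomp
    rw [inner_sub_right] at hcs
    have hpos : (0 : ℝ) < 2 * k + 1 := by positivity
    have h3 : (2 * k + 1 : ℝ)⁻¹ * (inner ℝ u hφ.derivLp - inner ℝ u hψ.derivLp)
        ≤ ‖hz.derivLp - p‖ * ‖u‖ := by linarith
    rw [inv_mul_le_iff₀ hpos] at h3
    linarith
  have h2 : inner ℝ f hψ.derivLp ≤ (totalVariation U f).toReal := by
    rw [inner_derivLp, setIntegral_inner_deriv_eq hψ, ← setIntegral_inner_deriv_eq hψU]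
    exact integral_le_toReal_totalVariation hf hψU (norm_powerField_le_one hη1 hz1)
  have h3 : -((2 * (k + 1 : ℝ))⁻¹ * ∫ x, ‖deriv (deriv η) x‖)
      ≤ inner ℝ hz.derivLp hψ.derivLp := by
    rw [inner_derivLp]
    have e : ∫ x in Ioo a b, inner ℝ (hz.derivLp x) (deriv (powerField η z k) x)
        = ∫ x in Ioo a b, inner ℝ (deriv z x) (deriv (powerField η z k) x) := by
      refine integral_congr_ae ?_
      filter_upwards [(hz.memLp_deriv 2 (volume.restrict (Ioo a b))).coeFn_toLp] with x hx
      rw [IsTestFunctionOn.derivLp, hx]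
    rw [e, setIntegral_inner_deriv_eq hψ]
    exact neg_le_integral_inner_deriv_powerField hη2 hη hz hη1 hz1
  have h4 : inner ℝ (hz.derivLp - p) hψ.derivLp ≤ ‖hz.derivLp - p‖ *
      ((eLpNorm (deriv η) 2 (volume.restrict (Ioo a b))).toReal + (2 * k + 1) * ‖hz.derivLp‖) :=
    (real_inner_le_norm _ _).trans (mul_le_mul_of_nonneg_left hnψ (norm_nonneg _))
  have h5 : inner ℝ u hψ.derivLp = inner ℝ f hψ.derivLp - l * inner ℝ hz.derivLp hψ.derivLp
      + l * inner ℝ (hz.derivLp - p) hψ.derivLp := by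
    rw [h.eq_sub, inner_sub_left, inner_smul_left, inner_sub_left]
    simp only [conj_trivial]
    ring
  have h6 := mul_le_mul_of_nonneg_left h3 hl.le
  have h7 := mul_le_mul_of_nonneg_left h4 hl.le
  rw [h5] at h1
  linarith

/-- On every open subset, the total variation of the minimizer is at most that of the datum. -/
theorem IsDualSolution.totalVariation_le_totalVariation (h : IsDualSolution l f u p) (hl : 0 < l)
    (hUo : IsOpen U) (hU : U ⊆ Ioo a b) : totalVariation U u ≤ totalVariation U f := by
  by_cases hf : totalVariation U f = ∞
  · simp [hf]
  refine _root_.totalVariation_le fun φ hφ h1 => ?_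
  rw [ENNReal.ofReal_le_iff_le_toReal hf, setIntegral_inner_deriv_eq hφ,
    ← setIntegral_inner_deriv_eq (hφ.mono hU), ← inner_derivLp (hφ.mono hU)]
  obtain ⟨η, hη2, hη, hηone, hη1⟩ := exists_smooth_cutoff hφ.2.1 hUo hφ.2.2
  have hφη : ∀ x, ‖φ x‖ ≤ η x := fun x => by
    by_cases hx : x ∈ tsupport φ
    · rw [hηone x hx]
      exact h1 x
    · rw [image_eq_zero_of_notMem_tsupport hx, norm_zero]
      exact (hη1 x).1
  -- approximations of the dual solution by admissible fields
  obtain ⟨d, hd, hdp⟩ := mem_closure_iff_seq_limit.1 h.mem_closure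
  choose z hz hz1 hzd using hd
  set A := (eLpNorm (deriv η) 2 (volume.restrict (Ioo a b))).toReal
  set M := ∫ x, ‖deriv (deriv η) x‖
  have step : ∀ k : ℕ, inner ℝ u (hφ.mono hU).derivLp
      ≤ (totalVariation U f).toReal + l * ((2 * (k + 1 : ℝ))⁻¹ * M) := fun k => by
    have hlim : Tendsto (fun j => (totalVariation U f).toReal + l * ((2 * (k + 1 : ℝ))⁻¹ * M)
        + ‖d j - p‖ * ((2 * k + 1) * ‖u‖ + l * (A + (2 * k + 1) * ‖d j‖))) atTop
        (𝓝 ((totalVariation U f).toReal + l * ((2 * (k + 1 : ℝ))⁻¹ * M)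
        + ‖p - p‖ * ((2 * k + 1) * ‖u‖ + l * (A + (2 * k + 1) * ‖p‖)))) :=
      tendsto_const_nhds.add ((hdp.sub_const p).norm.mul
        (tendsto_const_nhds.add ((tendsto_const_nhds.add (hdp.norm.const_mul _)).const_mul _)))
    rw [sub_self, norm_zero, zero_mul, add_zero] at hlim
    refine ge_of_tendsto' hlim fun j => ?_
    rw [← hzd j]
    exact h.inner_derivLp_le hl hU hf hη2 hη hη1 (hz j) (hz1 j) (hφ.mono hU) hφη
  have hlim : Tendsto (fun k : ℕ => (totalVariation U f).toReal
      + l * ((2 * (k + 1 : ℝ))⁻¹ * M)) atTop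
      (𝓝 ((totalVariation U f).toReal + l * (0 * M))) := by
    refine tendsto_const_nhds.add (((Tendsto.mul_const M ?_)).const_mul l)
    exact ((tendsto_natCast_atTop_atTop.atTop_add tendsto_const_nhds).const_mul_atTop
      two_pos).inv_tendsto_atTop
  rw [zero_mul, mul_zero, add_zero] at hlim
  exact ge_of_tendsto' hlim step

end Comparison

/-! ### Integrals against vector measures -/

section VectorIntegral

variable {X : Type*} [MeasurableSpace X] {E E' F F' G G' : Type*}
  [NormedAddCommGroup E] [NormedSpace ℝ E] [NormedAddCommGroup E'] [NormedSpace ℝ E']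
  [NormedAddCommGroup F] [NormedSpace ℝ F] [NormedAddCommGroup F'] [NormedSpace ℝ F']
  [NormedAddCommGroup G] [NormedSpace ℝ G] [NormedAddCommGroup G'] [NormedSpace ℝ G']
  {μ : VectorMeasure X F}

namespace MeasureTheory.VectorMeasure

/-- The image of a vector measure under a continuous linear map. -/
noncomputable def mapRangeL (μ : VectorMeasure X F) (R : F →L[ℝ] F') : VectorMeasure X F' :=
  μ.mapRange (R : F →+ F') R.continuous

@[simp]
theorem mapRangeL_apply (μ : VectorMeasure X F) (R : F →L[ℝ] F') (s : Set X) :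
    μ.mapRangeL R s = R (μ s) := rfl

theorem variation_mapRangeL_le (μ : VectorMeasure X F) (R : F →L[ℝ] F') :
    (μ.mapRangeL R).variation ≤ ‖R‖₊ • μ.variation := by
  refine variation_le_of_forall_enorm_le fun s _ => ?_
  rw [mapRangeL_apply]
  refine (R.le_opENorm _).trans ?_
  grw [enorm_measure_le_variation]
  rfl

instance isFiniteMeasure_variation_mapRangeL [IsFiniteMeasure μ.variation] (R : F →L[ℝ] F') :
    IsFiniteMeasure (μ.mapRangeL R).variation :=
  isFiniteMeasure_of_le _ (variation_mapRangeL_le μ R)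

/-- A linear map applied to the measure can be moved into the pairing. -/
theorem integral_mapRangeL {f : X → E} (hf : μ.Integrable f) (R : F →L[ℝ] F')
    (B : E →L[ℝ] F' →L[ℝ] G) :
    (μ.mapRangeL R).integral f B
      = μ.integral f (B.bilinearComp (ContinuousLinearMap.id ℝ E) R) := by
  rw [integral_eq_setToFun, integral_eq_setToFun]
  have hT : DominatedFinMeasAdditive μ.variation ((μ.mapRangeL R).transpose B)
      ‖B.bilinearComp (ContinuousLinearMap.id ℝ E) R‖ :=
    dominatedFinMeasAdditive_cbmApplyMeasure μ (B.bilinearComp (ContinuousLinearMap.id ℝ E) R)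
  rw [setToFun_congr_left (dominatedFinMeasAdditive_cbmApplyMeasure μ
    (B.bilinearComp (ContinuousLinearMap.id ℝ E) R)) hT rfl f]
  exact (setToFun_congr_measure_of_integrable ‖R‖₊ ENNReal.coe_ne_top
    (variation_mapRangeL_le μ R) hT (dominatedFinMeasAdditive_cbmApplyMeasure _ B) f hf).symm

/-- Continuous linear maps intertwining two pairings commute with the corresponding integrals. -/
theorem map_integral [CompleteSpace G] [CompleteSpace G'] [IsFiniteMeasure μ.variation]
    {f : X → E} (hf : μ.Integrable f) {B : E →L[ℝ] F →L[ℝ] G} {B' : E' →L[ℝ] F →L[ℝ] G'}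
    {S : E →L[ℝ] E'} {T : G →L[ℝ] G'} (h : ∀ x y, T (B x y) = B' (S x) y) :
    T (μ.integral f B) = μ.integral (fun x => S (f x)) B' := by
  refine Integrable.induction (μ := μ.variation)
    (fun f : X → E => T (μ.integral f B) = μ.integral (fun x => S (f x)) B') ?_ ?_ ?_ ?_ hf
  · intro c s hs _
    have e : (fun x => S (s.indicator (fun _ => c) x)) = s.indicator fun _ => S c := by
      ext1 x
      by_cases hx : x ∈ s <;> simp [hx]
    rw [e, integral_indicator_const _ hs, integral_indicator_const _ hs, h]
  · intro f g _ hf hg ihf ihg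
    have hSf : μ.Integrable (fun x => S (f x)) := S.integrable_comp hf
    have hSg : μ.Integrable (fun x => S (g x)) := S.integrable_comp hg
    have e : (fun x => S ((f + g) x)) = fun x => S (f x) + S (g x) := by
      ext1 x
      simp
    have e2 : μ.integral (f + g) B = μ.integral f B + μ.integral g B := integral_add hf hg
    rw [e, integral_fun_add hSf hSg, e2, _root_.map_add, ihf, ihg]
  · have e : ∀ f : X →₁[μ.variation] E, μ.integral (fun x => S (f x)) B'
        = μ.integral (S.compLpL 1 μ.variation f) B' := fun f =>
      integral_congr_ae (S.coeFn_compLpL f).symm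
    simp_rw [e]
    exact isClosed_eq (T.continuous.comp continuous_integral)
      (continuous_integral.comp (S.compLpL 1 μ.variation).continuous)
  · intro f g hfg _ ih
    rw [integral_congr_ae hfg.symm, ih]
    exact integral_congr_ae (hfg.fun_comp S)

/-- Vector measures with values in `ℝⁿ` have finite variation, since signed measures do. -/
instance isFiniteMeasure_variation {n : ℕ} (μ : VectorMeasure X (EuclideanSpace ℝ (Fin n))) :
    IsFiniteMeasure μ.variation := by
  have hfin : ∀ i, IsFiniteMeasure (μ.mapRangeL (EuclideanSpace.proj i)).variation := fun i => by
    rw [← SignedMeasure.totalVariation_eq_variation]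
    unfold SignedMeasure.totalVariation
    infer_instance
  refine isFiniteMeasure_of_le (∑ i, (μ.mapRangeL (EuclideanSpace.proj i)).variation)
    (variation_le_of_forall_enorm_le fun s _ => ?_)
  have h1 : ‖μ s‖ₑ ≤ ∑ i, ‖(μ s) i‖ₑ := by
    have e : μ s = ∑ i, (μ s) i • EuclideanSpace.single i (1 : ℝ) := by
      ext j
      simp [Finset.sum_apply, Pi.single_apply]
    calc ‖μ s‖ₑ = ‖∑ i, (μ s) i • EuclideanSpace.single i (1 : ℝ)‖ₑ := by rw [← e]
      _ ≤ ∑ i, ‖(μ s) i • EuclideanSpace.single i (1 : ℝ)‖ₑ := enorm_sum_le _ _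
      _ = _ := Finset.sum_congr rfl fun i _ => by
        rw [enorm_smul, ← ofReal_norm (EuclideanSpace.single i (1 : ℝ))]
        simp
  refine h1.trans ?_
  rw [Measure.finsetSum_apply]
  exact Finset.sum_le_sum fun i _ =>
    enorm_measure_le_variation (μ.mapRangeL (EuclideanSpace.proj i)) s

end MeasureTheory.VectorMeasure

end VectorIntegral

section Distribution

open VectorMeasure

variable {n : ℕ} {U : Set ℝ}

/-- Fubini: a test function integrates against a finite measure like minus its derivative against
the distribution function. -/
theorem IsTestFunctionOn.integral_measure_eq {φ : ℝ → ℝ} (hφ : IsTestFunctionOn U φ)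
    (m : Measure ℝ) [IsFiniteMeasure m] :
    ∫ y, φ y ∂m = -∫ x, deriv φ x * m.real (Iic x) := by
  have h1 : ∀ y, φ y = -∫ x, (Ici y).indicator (deriv φ) x := fun y => by
    rw [MeasureTheory.integral_indicator measurableSet_Ici, integral_Ici_eq_integral_Ioi,
      hφ.2.1.integral_Ioi_deriv_eq hφ.1, neg_neg]
  have hint : Integrable (deriv φ) :=
    hφ.continuous_deriv.integrable_of_hasCompactSupport hφ.2.1.deriv
  have hset : MeasurableSet {q : ℝ × ℝ | q.1 ≤ q.2} := measurableSet_le measurable_fst measurable_snd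
  have hI : Integrable (fun q : ℝ × ℝ => (Ici q.1).indicator (deriv φ) q.2) (m.prod volume) := by
    have e : (fun q : ℝ × ℝ => (Ici q.1).indicator (deriv φ) q.2)
        = {q : ℝ × ℝ | q.1 ≤ q.2}.indicator fun q => deriv φ q.2 := by
      ext1 q
      simp only [indicator, mem_Ici, mem_ofPred_eq]
    rw [e]
    exact (hint.comp_snd m).indicator hset
  calc ∫ y, φ y ∂m = ∫ y, (-∫ x, (Ici y).indicator (deriv φ) x) ∂m := by simp_rw [← h1]
    _ = -∫ x, (∫ y, (Ici y).indicator (deriv φ) x ∂m) := by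
      rw [MeasureTheory.integral_neg, integral_integral_swap hI]
    _ = _ := by
      congr 2
      ext1 x
      have e : (fun y => (Ici y).indicator (deriv φ) x) = (Iic x).indicator fun _ => deriv φ x := by
        ext1 y
        simp only [indicator, mem_Ici, mem_Iic]
      rw [e, MeasureTheory.integral_indicator measurableSet_Iic, MeasureTheory.setIntegral_const,
        smul_eq_mul, mul_comm]

theorem IsTestFunctionOn.integrable {φ : ℝ → ℝ} (hφ : IsTestFunctionOn U φ) (m : Measure ℝ)
    [IsFiniteMeasureOnCompacts m] : Integrable φ m :=
  hφ.1.continuous.integrable_of_hasCompactSupport hφ.2.1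

/-- The distribution function of a signed measure: Jordan decomposition reduces to the case of a
finite measure. -/
theorem IsTestFunctionOn.integral_signedMeasure_eq {φ : ℝ → ℝ} (hφ : IsTestFunctionOn U φ)
    (σ : SignedMeasure ℝ) :
    σ.integral φ (ContinuousLinearMap.lsmul ℝ ℝ) = -∫ x, deriv φ x * σ (Iic x) := by
  set j := σ.toJordanDecomposition
  have hσ : σ = j.posPart.toSignedMeasure - j.negPart.toSignedMeasure :=
    σ.toSignedMeasure_toJordanDecomposition.symm
  have hflip : (ContinuousLinearMap.lsmul ℝ ℝ : ℝ →L[ℝ] ℝ →L[ℝ] ℝ)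
      = (ContinuousLinearMap.lsmul ℝ ℝ).flip := by
    ext
    simp
  have hint : Integrable (deriv φ) :=
    hφ.continuous_deriv.integrable_of_hasCompactSupport hφ.2.1.deriv
  have hmul : ∀ m : Measure ℝ, IsFiniteMeasure m →
      Integrable (fun x => deriv φ x * m.real (Iic x)) := fun m _ => by
    refine hint.mul_bdd (c := m.real univ) ?_ (Eventually.of_forall fun x => ?_)
    · have hmono : Monotone fun x => m.real (Iic x) := fun x y hxy =>
        measureReal_mono (Iic_subset_Iic.2 hxy)
      exact hmono.measurable.aestronglyMeasurable
    · rw [Real.norm_of_nonneg measureReal_nonneg]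
      exact measureReal_mono (subset_univ _)
  have hv : ∀ x, σ (Iic x) = j.posPart.real (Iic x) - j.negPart.real (Iic x) := fun x => by
    rw [hσ, Measure.toSignedMeasure_sub_apply measurableSet_Iic]
  simp_rw [hv, mul_sub]
  rw [MeasureTheory.integral_sub (hmul _ inferInstance) (hmul _ inferInstance), hflip, hσ,
    integral_sub_vectorMeasure, integral_toSignedMeasure, integral_toSignedMeasure,
    hφ.integral_measure_eq, hφ.integral_measure_eq]
  · ring
  · rw [VectorMeasure.Integrable, Measure.variation_toSignedMeasure]
    exact hφ.integrable _
  · rw [VectorMeasure.Integrable, Measure.variation_toSignedMeasure]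
    exact hφ.integrable _

theorem integrable_deriv_smul_vectorMeasure_Iic {φ : ℝ → ℝ} (hφ : IsTestFunctionOn U φ)
    (μ : VectorMeasure ℝ (EuclideanSpace ℝ (Fin n))) :
    Integrable (fun x => deriv φ x • μ (Iic x)) := by
  have hset : MeasurableSet {q : ℝ × ℝ | q.2 ≤ q.1} := measurableSet_le measurable_snd measurable_fst
  exact (hφ.continuous_deriv.integrable_of_hasCompactSupport hφ.2.1.deriv).smul_bdd μ.bound
    (stronglyMeasurable_vectorMeasure_prodMk_left (ν := μ) hset).aestronglyMeasurable
    (Eventually.of_forall fun x => norm_apply_le_bound)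

/-- The distribution function `x ↦ μ(]-∞, x])` has distributional derivative `μ`. -/
theorem IsTestFunctionOn.integral_vectorMeasure_eq {φ : ℝ → ℝ} (hφ : IsTestFunctionOn U φ)
    (μ : VectorMeasure ℝ (EuclideanSpace ℝ (Fin n))) :
    μ.integral φ (ContinuousLinearMap.lsmul ℝ ℝ) = -∫ x, deriv φ x • μ (Iic x) := by
  ext i
  set P : EuclideanSpace ℝ (Fin n) →L[ℝ] ℝ := EuclideanSpace.proj i
  have hint : μ.Integrable φ := hφ.integrable _
  have h1 : P (μ.integral φ (ContinuousLinearMap.lsmul ℝ ℝ))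
      = (μ.mapRangeL P).integral φ (ContinuousLinearMap.lsmul ℝ ℝ) := by
    rw [integral_mapRangeL hint P]
    exact map_integral (S := ContinuousLinearMap.id ℝ ℝ) hint fun x y => by simp
  have h2 : P (∫ x, deriv φ x • μ (Iic x)) = ∫ x, deriv φ x * P (μ (Iic x)) := by
    rw [← P.integral_comp_comm (integrable_deriv_smul_vectorMeasure_Iic hφ μ)]
    simp
  change P (μ.integral φ (ContinuousLinearMap.lsmul ℝ ℝ)) = P (-∫ x, deriv φ x • μ (Iic x))
  rw [h1, hφ.integral_signedMeasure_eq, _root_.map_neg, h2]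
  rfl

end Distribution

/-! ### Comparison of derivative measures -/

section MeasureComparison

open VectorMeasure

variable {n : ℕ} {U O : Set ℝ} {f u : ℝ → EuclideanSpace ℝ (Fin n)}
  {μ ν : VectorMeasure ℝ (EuclideanSpace ℝ (Fin n))}

theorem IsTestFunctionOn.setIntegral_vectorMeasure_eq {φ : ℝ → ℝ} (hφ : IsTestFunctionOn U φ)
    (hU : MeasurableSet U) (B : ℝ →L[ℝ] EuclideanSpace ℝ (Fin n) →L[ℝ] EuclideanSpace ℝ (Fin n)) :
    (μ.restrict U).integral φ B = μ.integral φ B :=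
  setIntegral_eq_integral_of_forall_compl_eq_zero hU fun _ hx => hφ.eq_zero hx

theorem IsTestFunctionOn.setIntegral_deriv_smul_eq {φ : ℝ → ℝ} (hφ : IsTestFunctionOn U φ) :
    ∫ x in U, deriv φ x • u x = ∫ x, deriv φ x • u x :=
  MeasureTheory.setIntegral_eq_integral_of_forall_compl_eq_zero fun x hx => by
    simp [hφ.deriv_eq_zero hx]

theorem HasDerivMeasureOn.mono (h : HasDerivMeasureOn u U ν) (hO : MeasurableSet O)
    (hU : MeasurableSet U) (hOU : O ⊆ U) : HasDerivMeasureOn u O ν := fun φ hφ => by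
  rw [hφ.setIntegral_vectorMeasure_eq hO, hφ.setIntegral_deriv_smul_eq,
    ← (hφ.mono hOU).setIntegral_vectorMeasure_eq hU,
    ← (hφ.mono hOU).setIntegral_deriv_smul_eq]
  exact h φ (hφ.mono hOU)

theorem IsTestFunctionOn.coord {φ : ℝ → EuclideanSpace ℝ (Fin n)} (hφ : IsTestFunctionOn U φ)
    (i : Fin n) : IsTestFunctionOn U fun x => φ x i :=
  ⟨contDiff_euclidean.1 hφ.1 i, hφ.2.1.comp_left (g := fun v : EuclideanSpace ℝ (Fin n) => v i) rfl,
    (closure_mono fun x (hx : φ x i ≠ 0) (h : φ x = 0) => hx (by simp [h])).trans hφ.2.2⟩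

/-- The total variation is bounded by the variation of the derivative measure. -/
theorem HasDerivMeasureOn.totalVariation_le (h : HasDerivMeasureOn f O μ)
    (hO : MeasurableSet O) (hf : IntegrableOn f O) : totalVariation O f ≤ μ.variation O := by
  refine _root_.totalVariation_le fun φ hφ h1 => ?_
  let B : EuclideanSpace ℝ (Fin n) →L[ℝ] EuclideanSpace ℝ (Fin n) →L[ℝ] ℝ := innerSL ℝ
  have hφi : ∀ i, (μ.restrict O).Integrable fun x => φ x i := fun i =>
    (hφ.coord i).integrable _
  -- the pairing of `φ` with the measure, coordinate by coordinate
  have key : ∫ x in O, inner ℝ (f x) (deriv φ x) = -(μ.restrict O).integral φ B := by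
    have e1 : φ = fun x => ∑ i, φ x i • EuclideanSpace.single i (1 : ℝ) := by
      ext x j
      simp [Finset.sum_apply, Pi.single_apply]
    have e2 : ∀ x, inner ℝ (f x) (deriv φ x) = ∑ i, deriv (fun y => φ y i) x * f x i := fun x => by
      rw [PiLp.inner_apply]
      refine Finset.sum_congr rfl fun i _ => ?_
      have hd : deriv (fun y => φ y i) x = (deriv φ x) i :=
        ((EuclideanSpace.proj (𝕜 := ℝ) i).hasFDerivAt.comp_hasDerivAt x (hφ.hasDerivAt x)).deriv
      rw [hd]
      simp
    have e3 : ∀ i, Integrable (fun x => deriv (fun y => φ y i) x • f x) (volume.restrict O) :=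
      fun i => by
      obtain ⟨C, hC⟩ := (hφ.coord i).exists_bound_deriv
      exact hf.bdd_smul C (hφ.coord i).continuous_deriv.aestronglyMeasurable
        (Eventually.of_forall hC)
    have e4 : ∀ i, ∫ x in O, deriv (fun y => φ y i) x * f x i
        = -(μ.restrict O).integral (fun x => φ x i • EuclideanSpace.single i (1 : ℝ)) B := by
      intro i
      have e5 := (EuclideanSpace.proj (𝕜 := ℝ) i).integral_comp_comm (e3 i)
      rw [h _ (hφ.coord i), map_neg, map_integral (B' := B)
        (S := ContinuousLinearMap.toSpanSingleton ℝ (EuclideanSpace.single i (1 : ℝ))) (hφi i)] at e5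
      · simpa using e5
      · intro x y
        change x • y i = inner ℝ (x • EuclideanSpace.single i (1 : ℝ)) y
        rw [real_inner_smul_left, EuclideanSpace.inner_single_left]
        simp
    have e6 : ∀ i, Integrable (fun x => deriv (fun y => φ y i) x * f x i) (volume.restrict O) :=
      fun i => (EuclideanSpace.proj (𝕜 := ℝ) i).integrable_comp (e3 i)
    simp_rw [e2]
    rw [MeasureTheory.integral_finsetSum _ fun i _ => e6 i]
    simp_rw [e4]
    rw [Finset.sum_neg_distrib, ← VectorMeasure.integral_finsetSum, ← e1]
    intro i _
    exact (hφi i).smul_const _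
  have hB : ‖B‖ₑ ≤ 1 := by
    rw [← ofReal_norm, ENNReal.ofReal_le_one]
    exact norm_innerSL_le _
  calc ENNReal.ofReal (∫ x in O, inner ℝ (f x) (deriv φ x))
      ≤ ‖(μ.restrict O).integral φ B‖ₑ := by
        rw [key, ← ofReal_norm]
        exact ENNReal.ofReal_le_ofReal (neg_le_abs _)
    _ ≤ 1 * ‖B‖ₑ * (μ.restrict O).variation univ :=
      enorm_integral_le_of_enorm_le_const (Eventually.of_forall fun x => by
        rw [← ofReal_norm, ENNReal.ofReal_le_one]
        exact h1 x)
    _ ≤ 1 * 1 * (μ.restrict O).variation univ := by gcongr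
    _ = μ.variation O := by rw [variation_restrict hO]; simp

/-- Cut-off functions pair with the derivative measure to at most the total variation. -/
theorem HasDerivMeasureOn.enorm_integral_le (h : HasDerivMeasureOn u O ν)
    (hO : MeasurableSet O) (hu : IntegrableOn u O) {χ : ℝ → ℝ} (hχ : IsTestFunctionOn O χ)
    (hχ1 : ∀ x, 0 ≤ χ x ∧ χ x ≤ 1) :
    ‖ν.integral χ (ContinuousLinearMap.lsmul ℝ ℝ)‖ₑ ≤ totalVariation O u := by
  set w := ν.integral χ (ContinuousLinearMap.lsmul ℝ ℝ) with hw
  have h1 : ∫ x in O, deriv χ x • u x = -w := by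
    rw [h χ hχ, hχ.setIntegral_vectorMeasure_eq hO]
  -- the unit vector in the direction of `-w`
  set e : EuclideanSpace ℝ (Fin n) := -(‖w‖⁻¹ • w) with he
  have he1 : ‖e‖ ≤ 1 := by
    rw [he, norm_neg, norm_smul, norm_inv, norm_norm]
    exact inv_mul_le_one
  have hφ : IsTestFunctionOn O fun x => χ x • e := hχ.smul contDiff_const
  obtain ⟨C, hC⟩ := hχ.exists_bound_deriv
  have hint : Integrable (fun x => deriv χ x • u x) (volume.restrict O) :=
    hu.bdd_smul C hχ.continuous_deriv.aestronglyMeasurable (Eventually.of_forall hC)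
  have h2 : ∫ x in O, inner ℝ (u x) (deriv (fun y => χ y • e) x) = ‖w‖ := by
    have e1 : ∀ x, inner ℝ (u x) (deriv (fun y => χ y • e) x) = inner ℝ e (deriv χ x • u x) :=
      fun x => by
      rw [((hχ.hasDerivAt x).smul_const e).deriv, inner_smul_right, inner_smul_right,
        real_inner_comm]
    simp_rw [e1]
    rw [integral_inner hint, h1, he, inner_neg_neg, inner_smul_left, real_inner_self_eq_norm_sq]
    by_cases hz : ‖w‖ = 0
    · simp [hz]
    · simp only [conj_trivial]
      field_simp
  rw [← ofReal_norm, ← h2]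
  refine le_totalVariation hφ fun x => ?_
  rw [norm_smul, Real.norm_of_nonneg (hχ1 x).1]
  exact mul_le_one₀ (hχ1 x).2 (norm_nonneg _) he1

/-- Replacing the indicator function of `S` by a cut-off costs at most the variation of the region
where the two can differ. -/
theorem enorm_apply_sub_integral_le {S K O : Set ℝ} {χ : ℝ → ℝ} (hS : MeasurableSet S)
    (hO : MeasurableSet O) (hK : MeasurableSet K) (hKS : K ⊆ S) (hSO : S ⊆ O)
    (hχ : IsTestFunctionOn O χ) (hχK : ∀ x ∈ K, χ x = 1) (hχ1 : ∀ x, 0 ≤ χ x ∧ χ x ≤ 1) :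
    ‖ν S - ν.integral χ (ContinuousLinearMap.lsmul ℝ ℝ)‖ₑ ≤ ν.variation (O \ K) := by
  have h1S : ν.Integrable (S.indicator fun _ => (1 : ℝ)) := (integrable_const _).indicator hS
  have e : ν S = ν.integral (S.indicator fun _ => (1 : ℝ)) (ContinuousLinearMap.lsmul ℝ ℝ) := by
    rw [VectorMeasure.integral_indicator_const _ hS]
    simp
  rw [e, ← VectorMeasure.integral_fun_sub h1S (hχ.integrable _)]
  refine enorm_integral_le_lintegral_enorm_transpose.trans ?_
  rw [variation_transpose_lsmul, ← lintegral_indicator_one (hO.diff hK)]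
  refine lintegral_mono fun x => ?_
  by_cases hxK : x ∈ K
  · simp [hχK x hxK, hKS hxK]
  by_cases hxO : x ∈ O
  · rw [indicator_of_mem (show x ∈ O \ K from ⟨hxO, hxK⟩), ← ofReal_norm, Pi.one_apply,
      ENNReal.ofReal_le_one, Real.norm_eq_abs, abs_le]
    obtain ⟨h0, h1⟩ := hχ1 x
    by_cases hxS : x ∈ S
    · rw [indicator_of_mem hxS]
      constructor <;> linarith
    · rw [indicator_of_notMem hxS]
      constructor <;> linarith
  · rw [indicator_of_notMem (fun h => hxO (hSO h)), hχ.eq_zero hxO]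
    simp

/-- Comparison of total variations on open sets gives comparison of the derivative measures on
Borel sets, by regularity. -/
theorem variation_le_variation_of_totalVariation_le (hU : IsOpen U) (hf : IntegrableOn f U)
    (hu : IntegrableOn u U) (hTV : ∀ O, IsOpen O → O ⊆ U → totalVariation O u ≤ totalVariation O f)
    (hμ : HasDerivMeasureOn f U μ) (hν : HasDerivMeasureOn u U ν) {A : Set ℝ}
    (hA : MeasurableSet A) (hAU : A ⊆ U) : ν.variation A ≤ μ.variation A := by
  refine variation_apply_le_of_forall_enorm_le hA fun S hS hSA => ?_
  refine ENNReal.le_of_forall_pos_le_add fun ε hε _ => ?_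
  set m := μ.variation + ν.variation
  have hε4 : (ε / 2 / 2 : ℝ≥0∞) ≠ 0 := by simp [hε.ne']
  obtain ⟨O', hSO', hO', -, hmO'⟩ := hS.exists_isOpen_sdiff_lt (μ := m) (measure_ne_top _ _) hε4
  obtain ⟨K, hKS, hK, hmK⟩ := hS.exists_isCompact_sdiff_lt (μ := m) (measure_ne_top _ _) hε4
  obtain ⟨χ, -, hχ, hχK, hχ1⟩ := exists_smooth_cutoff hK (hO'.inter hU)
    (subset_inter (hKS.trans hSO') ((hKS.trans hSA).trans hAU))
  set O := O' ∩ U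
  have hO : MeasurableSet O := (hO'.inter hU).measurableSet
  have hOU : O ⊆ U := inter_subset_right
  have hSO : S ⊆ O := subset_inter hSO' (hSA.trans hAU)
  have hmO : m (O \ S) ≤ ε / 2 / 2 :=
    (measure_mono (sdiff_subset_sdiff_left inter_subset_left)).trans hmO'.le
  have hmOK : m (O \ K) ≤ ε / 2 := by
    have hsub : O \ K ⊆ (O \ S) ∪ (S \ K) := fun x hx => by
      by_cases hxS : x ∈ S
      · exact Or.inr ⟨hxS, hx.2⟩
      · exact Or.inl ⟨hx.1, hxS⟩
    calc m (O \ K) ≤ m (O \ S) + m (S \ K) := (measure_mono hsub).trans (measure_union_le _ _)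
      _ ≤ ε / 2 / 2 + ε / 2 / 2 := add_le_add hmO hmK.le
      _ = ε / 2 := ENNReal.add_halves _
  have hμm : μ.variation ≤ m := Measure.le_add_right le_rfl
  have hνm : ν.variation ≤ m := Measure.le_add_left le_rfl
  have hdiff := (enorm_apply_sub_integral_le (ν := ν) hS hO hK.measurableSet hKS hSO hχ hχK
    hχ1).trans ((hνm _).trans hmOK)
  have hmain : ‖ν.integral χ (ContinuousLinearMap.lsmul ℝ ℝ)‖ₑ ≤ μ.variation S + ε / 2 := by
    calc _ ≤ totalVariation O u :=
          (hν.mono hO hU.measurableSet hOU).enorm_integral_le hO (hu.mono_set hOU) hχ hχ1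
      _ ≤ totalVariation O f := hTV O (hO'.inter hU) hOU
      _ ≤ μ.variation O :=
        (hμ.mono hO hU.measurableSet hOU).totalVariation_le hO (hf.mono_set hOU)
      _ = μ.variation S + μ.variation (O \ S) := by
        rw [← measure_inter_add_sdiff O hS, inter_eq_self_of_subset_right hSO]
      _ ≤ μ.variation S + ε / 2 :=
        add_le_add le_rfl (((hμm _).trans hmO).trans ENNReal.half_le_self)
  set w := ν.integral χ (ContinuousLinearMap.lsmul ℝ ℝ)
  calc ‖ν S‖ₑ = ‖w + (ν S - w)‖ₑ := by rw [add_sub_cancel]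
    _ ≤ ‖w‖ₑ + ‖ν S - w‖ₑ := enorm_add_le _ _
    _ ≤ μ.variation S + ε / 2 + ε / 2 := add_le_add hmain hdiff
    _ = μ.variation S + ε := by rw [add_assoc, ENNReal.add_halves]

end MeasureComparison

/-! ### Functions of finite total variation are of bounded variation -/

section Mollification

variable {n : ℕ} {a b r : ℝ} {u : ℝ → EuclideanSpace ℝ (Fin n)} {ρ : ℝ → ℝ}

/-- The primitive of a mollifier is a smooth step from `0` to `1`. -/
theorem exists_monotone_primitive (hρ : Continuous ρ) (h0 : ∀ x, 0 ≤ ρ x) (h1 : ∫ x, ρ x = 1)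
    (hs : Function.support ρ ⊆ Ioo (-r) r) :
    ∃ R : ℝ → ℝ, (∀ x, HasDerivAt R (ρ x) x) ∧ Monotone R ∧ (∀ x ≤ -r, R x = 0) ∧
      ∀ x, r ≤ x → R x = 1 := by
  have hd : ∀ x, HasDerivAt (fun x => ∫ t in (-r)..x, ρ t) (ρ x) x := fun x =>
    hρ.integral_hasStrictDerivAt (-r) x |>.hasDerivAt
  refine ⟨_, hd, monotone_of_deriv_nonneg (fun x => (hd x).differentiableAt) fun x => ?_,
    fun x hx => ?_, fun x hx => ?_⟩
  · rw [(hd x).deriv]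
    exact h0 x
  · refine intervalIntegral.integral_zero_ae (Eventually.of_forall fun t ht => ?_)
    rw [uIoc_of_ge hx] at ht
    exact Function.notMem_support.1 fun h => (hs h).1.not_ge ht.2
  · rw [intervalIntegral.integral_eq_integral_of_support_subset, h1]
    exact fun t ht => ⟨(hs ht).1, (hs ht).2.le.trans hx⟩

/-- The increments of a mollified function along a finite monotone sequence are tested by a convex
combination of unit vectors, hence controlled by the total variation. -/
theorem sum_edist_mollified_le (hρ : Continuous ρ) (h0 : ∀ x, 0 ≤ ρ x) (h1 : ∫ x, ρ x = 1)
    (hs : Function.support ρ ⊆ Ioo (-r) r) (hu : IntegrableOn u (Ioo a b))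
    {x : ℕ → ℝ} (hx : Monotone x) {N : ℕ} (ha : a < x 0 - r) (hb : x N + r < b) :
    ∑ i ∈ Finset.range N, edist (∫ y in Ioo a b, ρ (x (i + 1) - y) • u y)
      (∫ y in Ioo a b, ρ (x i - y) • u y) ≤ totalVariation (Ioo a b) u := by
  obtain ⟨R, hR, hRm, hR0, hR1⟩ := exists_monotone_primitive hρ h0 h1 hs
  have hRC : ContDiff ℝ 1 R := by
    rw [contDiff_one_iff_deriv]
    refine ⟨fun y => (hR y).differentiableAt, ?_⟩
    have e : deriv R = ρ := funext fun y => (hR y).deriv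
    rwa [e]
  have hint : ∀ c, Integrable (fun y => ρ (c - y) • u y) (volume.restrict (Ioo a b)) := fun c => by
    have hcs : HasCompactSupport ρ := HasCompactSupport.intro (isCompact_Icc (a := -r) (b := r))
      fun y hy => Function.notMem_support.1 fun h => hy (Ioo_subset_Icc_self (hs h))
    obtain ⟨C, hC⟩ := hcs.exists_bound_of_continuous hρ
    exact hu.bdd_smul C (hρ.comp (continuous_const.sub continuous_id)).aestronglyMeasurable
      (Eventually.of_forall fun y => hC _)
  set d : ℕ → EuclideanSpace ℝ (Fin n) := fun i =>
    (∫ y in Ioo a b, ρ (x (i + 1) - y) • u y) - ∫ y in Ioo a b, ρ (x i - y) • u y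
  set e : ℕ → EuclideanSpace ℝ (Fin n) := fun i => ‖d i‖⁻¹ • d i with he
  have he1 : ∀ i, ‖e i‖ ≤ 1 := fun i => by
    rw [he, norm_smul, norm_inv, norm_norm]
    exact inv_mul_le_one
  have hed : ∀ i, inner ℝ (e i) (d i) = ‖d i‖ := fun i => by
    rw [he, inner_smul_left, real_inner_self_eq_norm_sq]
    by_cases hz : ‖d i‖ = 0
    · simp [hz]
    · simp only [conj_trivial]
      field_simp
  -- the test function
  set φ : ℝ → EuclideanSpace ℝ (Fin n) := fun y =>
    ∑ i ∈ Finset.range N, (R (x i - y) - R (x (i + 1) - y)) • e i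
  have hφd : ∀ y, deriv φ y = ∑ i ∈ Finset.range N, (ρ (x (i + 1) - y) - ρ (x i - y)) • e i :=
    fun y => by
    refine (HasDerivAt.fun_sum fun i _ => ?_).deriv
    have h := (((hR (x i - y)).comp_const_sub (x i) y).fun_sub
      ((hR (x (i + 1) - y)).comp_const_sub (x (i + 1)) y)).smul_const (e i)
    rwa [neg_sub_neg] at h
  have hφ0 : ∀ y ∉ Icc (x 0 - r) (x N + r), φ y = 0 := fun y hy => by
    refine Finset.sum_eq_zero fun i hi => ?_
    have hi1 : i + 1 ≤ N := Finset.mem_range.1 hi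
    have m0 := hx (Nat.zero_le i)
    have m1 := hx (Nat.le_succ i)
    have m2 := hx hi1
    simp only [Nat.succ_eq_add_one] at m1
    rcases lt_or_ge y (x 0 - r) with hlt | hge
    · rw [hR1 _ (by linarith), hR1 _ (by linarith), sub_self, zero_smul]
    · have hgt : x N + r < y := by
        by_contra hle
        exact hy ⟨hge, not_lt.1 hle⟩
      rw [hR0 _ (by linarith), hR0 _ (by linarith), sub_self, zero_smul]
  have hsupp : tsupport φ ⊆ Icc (x 0 - r) (x N + r) :=
    closure_minimal (fun y hy => by_contra fun h => hy (hφ0 y h)) isClosed_Icc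
  have htest : IsTestFunctionOn (Ioo a b) φ := by
    refine ⟨ContDiff.sum fun i _ => ?_, HasCompactSupport.intro isCompact_Icc hφ0, fun y hy => ?_⟩
    · exact ((hRC.comp (contDiff_const.sub contDiff_id)).sub
        (hRC.comp (contDiff_const.sub contDiff_id))).smul contDiff_const
    · exact ⟨ha.trans_le (hsupp hy).1, (hsupp hy).2.trans_lt hb⟩
  have hR01 : ∀ y, 0 ≤ R y ∧ R y ≤ 1 := fun y =>
    ⟨(hR0 (min y (-r)) (min_le_right _ _)).symm.le.trans (hRm (min_le_left _ _)),
      (hRm (le_max_left y r)).trans (hR1 _ (le_max_right _ _)).le⟩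
  have hφ1 : ∀ y, ‖φ y‖ ≤ 1 := fun y => by
    calc ‖φ y‖ ≤ ∑ i ∈ Finset.range N, (R (x (i + 1) - y) - R (x i - y)) := by
          refine norm_sum_le_of_le _ fun i _ => ?_
          have hm : R (x i - y) ≤ R (x (i + 1) - y) := hRm (by linarith [hx (Nat.le_succ i)])
          rw [norm_smul, Real.norm_eq_abs, abs_of_nonpos (by linarith), neg_sub]
          exact mul_le_of_le_one_right (by linarith) (he1 i)
      _ = R (x N - y) - R (x 0 - y) := Finset.sum_range_sub (fun i => R (x i - y)) N
      _ ≤ 1 := by linarith [(hR01 (x N - y)).2, (hR01 (x 0 - y)).1]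
  have hpair : ∫ y in Ioo a b, inner ℝ (u y) (deriv φ y) = ∑ i ∈ Finset.range N, ‖d i‖ := by
    have e1 : ∀ y, inner ℝ (u y) (deriv φ y) = ∑ i ∈ Finset.range N,
        inner ℝ (e i) (ρ (x (i + 1) - y) • u y - ρ (x i - y) • u y) := fun y => by
      rw [hφd, inner_sum]
      refine Finset.sum_congr rfl fun i _ => ?_
      rw [← sub_smul, real_inner_smul_right (u y) (e i), real_inner_smul_right (e i) (u y),
        real_inner_comm (e i) (u y)]
    simp_rw [e1]
    have hi : ∀ i, Integrable (fun y => ρ (x (i + 1) - y) • u y - ρ (x i - y) • u y)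
        (volume.restrict (Ioo a b)) := fun i => (hint _).sub (hint _)
    rw [integral_finsetSum _ fun i _ => (hi i).const_inner (e i)]
    refine Finset.sum_congr rfl fun i _ => ?_
    rw [integral_inner (hi i), integral_sub (hint _) (hint _)]
    exact hed i
  calc _ = ∑ i ∈ Finset.range N, ENNReal.ofReal ‖d i‖ :=
        Finset.sum_congr rfl fun i _ => by rw [edist_eq_enorm_sub, ofReal_norm]
    _ = ENNReal.ofReal (∫ y in Ioo a b, inner ℝ (u y) (deriv φ y)) := by
      rw [hpair, ENNReal.ofReal_sum_of_nonneg fun i _ => norm_nonneg _]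
    _ ≤ _ := le_totalVariation htest hφ1

/-- An integrable function has pointwise variation at most its total variation on a set of full
measure, namely the set where its mollifications converge to it. -/
theorem exists_eVariationOn_le_totalVariation (hu : IntegrableOn u (Ioo a b)) :
    ∃ s ⊆ Ioo a b, (∀ᵐ x, x ∈ Ioo a b → x ∈ s) ∧
      eVariationOn u s ≤ totalVariation (Ioo a b) u := by
  let ρ : ℕ → ContDiffBump (0 : ℝ) := fun k =>
    ⟨1 / (k + 1), 2 * (1 / (k + 1)), by positivity, by
      have : (0 : ℝ) < 1 / (k + 1) := by positivity
      linarith⟩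
  have hlim : Tendsto (fun k => (ρ k).rOut) atTop (𝓝 0) := by
    have h := (tendsto_one_div_add_atTop_nhds_zero_nat (𝕜 := ℝ)).const_mul 2
    rwa [mul_zero] at h
  have hw : LocallyIntegrable ((Ioo a b).indicator u) :=
    (hu.integrable_indicator measurableSet_Ioo).locallyIntegrable
  have hae := ContDiffBump.ae_convolution_tendsto_right_of_locallyIntegrable (K := 2) hlim
    (Eventually.of_forall fun k => le_rfl) hw
  set M : ℕ → ℝ → EuclideanSpace ℝ (Fin n) := fun k x =>
    ∫ y in Ioo a b, (ρ k).normed volume (x - y) • u y with hM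
  refine ⟨{x ∈ Ioo a b | Tendsto (fun k => M k x) atTop (𝓝 (u x))}, fun x hx => hx.1, ?_, ?_⟩
  · filter_upwards [hae] with x hx hxI
    refine ⟨hxI, ?_⟩
    rw [indicator_of_mem hxI] at hx
    refine hx.congr fun k => ?_
    rw [convolution_eq_swap, hM]
    simp only [ContinuousLinearMap.lsmul_apply]
    rw [← integral_indicator measurableSet_Ioo]
    congr 1
    ext1 y
    by_cases hy : y ∈ Ioo a b <;> simp [hy]
  · refine iSup_le fun ⟨N, x, hxm, hxs⟩ => ?_
    have hconv : Tendsto (fun k => ∑ i ∈ Finset.range N, edist (M k (x (i + 1))) (M k (x i))) atTop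
        (𝓝 (∑ i ∈ Finset.range N, edist (u (x (i + 1))) (u (x i)))) :=
      tendsto_finsetSum _ fun i _ => (hxs (i + 1)).2.edist (hxs i).2
    refine le_of_tendsto hconv ?_
    have h1 : ∀ᶠ k in atTop, (ρ k).rOut < x 0 - a :=
      hlim.eventually_lt_const (by linarith [(hxs 0).1.1])
    have h2 : ∀ᶠ k in atTop, (ρ k).rOut < b - x N :=
      hlim.eventually_lt_const (by linarith [(hxs N).1.2])
    filter_upwards [h1, h2] with k hk1 hk2
    refine sum_edist_mollified_le (r := (ρ k).rOut) (ρ k).continuous_normed (ρ k).nonneg_normed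
      (ρ k).integral_normed ?_ hu hxm (by linarith) (by linarith)
    rw [ContDiffBump.support_normed_eq, Real.ball_eq_Ioo, zero_sub, zero_add]

end Mollification

section Extension

/-- A function of bounded variation is a `1`-Lipschitz function of its variation function. -/
theorem dist_le_dist_variationOnFromTo {F : Type*} [PseudoMetricSpace F] {f : ℝ → F} {s : Set ℝ}
    (hf : BoundedVariationOn f s) {x₀ x y : ℝ}
    (h₀ : x₀ ∈ s) (hx : x ∈ s) (hy : y ∈ s) :
    dist (f x) (f y) ≤ dist (variationOnFromTo f s x₀ x) (variationOnFromTo f s x₀ y) := by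
  wlog hxy : x ≤ y generalizing x y
  · rw [dist_comm, dist_comm (variationOnFromTo f s x₀ x)]
    exact this hy hx (not_le.1 hxy).le
  have hfin : eVariationOn f (s ∩ Icc x y) ≠ ∞ := hf.mono inter_subset_left
  rw [dist_comm (variationOnFromTo f s x₀ x), Real.dist_eq,
    variationOnFromTo.sub_right hf.locallyBoundedVariationOn h₀ hy hx,
    variationOnFromTo.eq_of_le f s hxy, ENNReal.abs_toReal, dist_edist]
  exact ENNReal.toReal_mono hfin
    (eVariationOn.edist_le f ⟨hx, left_mem_Icc.2 hxy⟩ ⟨hy, right_mem_Icc.2 hxy⟩)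

variable {F : Type*} [NormedAddCommGroup F] [NormedSpace ℝ F] [FiniteDimensional ℝ F]
  {f : ℝ → F} {s : Set ℝ}

/-- A function of bounded variation on a set extends to a function of bounded variation on the
line: it is a Lipschitz function of its (monotone) variation function, and both factors extend. -/
theorem BoundedVariationOn.exists_extension (hf : BoundedVariationOn f s) :
    ∃ g : ℝ → F, BoundedVariationOn g univ ∧ EqOn g f s ∧ {x | ¬ContinuousAt g x}.Countable := by
  rcases s.eq_empty_or_nonempty with rfl | ⟨x₀, h₀⟩
  · refine ⟨0, ?_, eqOn_empty _ _, ?_⟩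
    · rw [BoundedVariationOn, eVariationOn.constant_on]
      · exact ENNReal.zero_ne_top
      · rintro _ ⟨x, -, rfl⟩ _ ⟨y, -, rfl⟩
        rfl
    · have : {x | ¬ContinuousAt (0 : ℝ → F) x} = ∅ := by
        ext x
        simpa using (continuous_zero : Continuous (0 : ℝ → F)).continuousAt
      rw [this]
      exact countable_empty
  set V : ℝ → ℝ := variationOnFromTo f s x₀
  set C : ℝ := (eVariationOn f s).toReal
  have hVC : ∀ x, |V x| ≤ C := fun x => variationOnFromTo.abs_le_eVariationOn hf
  have hVm : MonotoneOn V s := variationOnFromTo.monotoneOn hf.locallyBoundedVariationOn h₀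
  obtain ⟨W, hWm, hW⟩ := hVm.exists_monotone_extension
    ⟨-C, by rintro _ ⟨x, -, rfl⟩; exact (abs_le.1 (hVC x)).1⟩
    ⟨C, by rintro _ ⟨x, -, rfl⟩; exact (abs_le.1 (hVC x)).2⟩
  -- truncation makes the extended variation function bounded
  have hTm : Monotone fun x => max (-C) (min C (W x)) := fun x y hxy =>
    max_le_max le_rfl (min_le_min le_rfl (hWm hxy))
  have hTb : ∀ x, |max (-C) (min C (W x))| ≤ C := fun x =>
    abs_le.2 ⟨le_max_left _ _, max_le (by linarith [(abs_nonneg _).trans (hVC 0)]) (min_le_left _ _)⟩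
  have hTV : ∀ x ∈ s, max (-C) (min C (W x)) = V x := fun x hx => by
    rw [← hW hx, min_eq_right (abs_le.1 (hVC x)).2, max_eq_right (abs_le.1 (hVC x)).1]
  -- the factorization through the variation function
  have hdist : ∀ x ∈ s, ∀ y ∈ s, dist (f x) (f y) ≤ dist (V x) (V y) := fun x hx y hy =>
    dist_le_dist_variationOnFromTo hf h₀ hx hy
  set h : ℝ → F := fun t => f (Function.invFunOn V s t)
  have hinv : ∀ x ∈ s, Function.invFunOn V s (V x) ∈ s ∧ V (Function.invFunOn V s (V x)) = V x :=
    fun x hx => ⟨Function.invFunOn_mem ⟨x, hx, rfl⟩, Function.invFunOn_eq ⟨x, hx, rfl⟩⟩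
  have hhV : ∀ x ∈ s, h (V x) = f x := fun x hx => by
    have := hdist _ (hinv x hx).1 x hx
    rw [(hinv x hx).2, dist_self] at this
    exact dist_le_zero.1 this
  have hLip : LipschitzOnWith 1 h (V '' s) := by
    refine LipschitzOnWith.of_dist_le_mul ?_
    rintro _ ⟨x, hx, rfl⟩ _ ⟨y, hy, rfl⟩
    rw [hhV x hx, hhV y hy, NNReal.coe_one, one_mul]
    exact hdist x hx y hy
  obtain ⟨H, hH, hHh⟩ := hLip.extend_finite_dimension
  refine ⟨H ∘ fun x => max (-C) (min C (W x)), hH.comp_boundedVariationOn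
    ((hTm.monotoneOn univ).boundedVariationOn fun x _ => hTb x), fun x hx => ?_,
    hTm.countable_not_continuousAt.mono fun x hx hc => hx (hH.continuous.continuousAt.comp hc)⟩
  rw [Function.comp_apply, hTV x hx, ← hHh ⟨x, hx, rfl⟩, hhV x hx]

end Extension

section MemBV

variable {n : ℕ} {a b : ℝ} {u : ℝ → EuclideanSpace ℝ (Fin n)}

/-- Integrable functions of finite total variation have a derivative measure. -/
theorem memBV_of_totalVariation_ne_top (hu : IntegrableOn u (Ioo a b))
    (hTV : totalVariation (Ioo a b) u ≠ ∞) : MemBV u (Ioo a b) := by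
  obtain ⟨s, hsI, hs, hsV⟩ := exists_eVariationOn_le_totalVariation hu
  have hBV : BoundedVariationOn u s := ne_top_of_le_ne_top hTV hsV
  obtain ⟨g, hg, hgu, hgc⟩ := hBV.exists_extension
  set μ := hg.vectorMeasure
  set c := limUnder atBot g
  have hae : ∀ᵐ x, x ∈ Ioo a b → u x = μ (Iic x) + c := by
    filter_upwards [hs, hgc.ae_notMem volume] with x hx hxc hxI
    have hcont : ContinuousAt g x := not_not.1 hxc
    rw [hg.vectorMeasure_Iic, hcont.continuousWithinAt.rightLim_eq, sub_add_cancel,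
      hgu (hx hxI)]
  refine ⟨hu, μ, fun φ hφ => ?_⟩
  have hint : Integrable (deriv φ) :=
    hφ.continuous_deriv.integrable_of_hasCompactSupport hφ.2.1.deriv
  rw [hφ.setIntegral_vectorMeasure_eq measurableSet_Ioo, hφ.integral_vectorMeasure_eq, neg_neg,
    hφ.setIntegral_deriv_smul_eq]
  calc ∫ x, deriv φ x • u x = ∫ x, (deriv φ x • μ (Iic x) + deriv φ x • c) := by
        refine integral_congr_ae ?_
        filter_upwards [hae] with x hx
        by_cases hxI : x ∈ Ioo a b
        · rw [hx hxI, smul_add]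
        · simp [hφ.deriv_eq_zero hxI]
    _ = ∫ x, deriv φ x • μ (Iic x) := by
      rw [integral_add (integrable_deriv_smul_vectorMeasure_Iic hφ μ) (hint.smul_const c),
        integral_smul_const, hφ.integral_deriv, zero_smul, add_zero]

end MemBV

/-! ### The minimizer of the total variation energy -/

theorem MemBV.mono {n : ℕ} {U V : Set ℝ} {u : ℝ → EuclideanSpace ℝ (Fin n)} (h : MemBV u V)
    (hU : MeasurableSet U) (hV : MeasurableSet V) (hUV : U ⊆ V) : MemBV u U :=
  ⟨h.1.mono_set hUV, h.2.imp fun _ hμ => hμ.mono hU hV hUV⟩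

theorem mainTheorem1 (n : ℕ) (a b l : ℝ) (hab : a < b) (hl : 0 < l) (f : L2Space n a b) :
    (∃! u : L2Space n a b, IsTVMinimizer l f u) ∧
    ∀ u : L2Space n a b, IsTVMinimizer l f u →
      MemBV u (Ioo a b) ∧
      (∀ c d : ℝ, c < d → Ioo c d ⊆ Ioo a b → MemBV f (Ioo c d) →
        MemBV u (Ioo c d) ∧
        ∀ μ ν : VectorMeasure ℝ (EuclideanSpace ℝ (Fin n)),
          HasDerivMeasureOn f (Ioo c d) μ → HasDerivMeasureOn u (Ioo c d) ν →
          ∀ A : Set ℝ, MeasurableSet A → A ⊆ Ioo c d → ν.variation A ≤ μ.variation A) ∧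
      (∀ c d : ℝ, c < d → Ioo c d ⊆ Ioo a b →
        totalVariation (Ioo c d) u ≤ totalVariation (Ioo c d) f) := by
  obtain ⟨v, p, h⟩ := exists_isDualSolution hl f
  refine ⟨⟨v, (h.isTVMinimizer_iff hl).2 rfl, fun w hw => (h.isTVMinimizer_iff hl).1 hw⟩, ?_⟩
  intro u hu
  obtain rfl := (h.isTVMinimizer_iff hl).1 hu
  have hint : IntegrableOn u (Ioo a b) := (Lp.memLp u).integrable one_le_two
  have hBV : MemBV u (Ioo a b) := memBV_of_totalVariation_ne_top hint
    (ne_top_of_le_ne_top ENNReal.ofReal_ne_top h.totalVariation_le)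
  refine ⟨hBV, fun c d _ hcd hf => ?_, fun c d _ hcd =>
    h.totalVariation_le_totalVariation hl isOpen_Ioo hcd⟩
  have hBV' := hBV.mono measurableSet_Ioo measurableSet_Ioo hcd
  exact ⟨hBV', fun μ ν hμ hν A hA hAU =>
    variation_le_variation_of_totalVariation_le isOpen_Ioo hf.1 hBV'.1
      (fun O hO hOU => h.totalVariation_le_totalVariation hl hO (hOU.trans hcd)) hμ hν hA hAU⟩
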